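/- Let $\mathbb{BC}=\{Z=z_1+jz_2 : z_1,z_2\in\mathbb{C}\}$ be the bicomplex numbers ($j^2=-1$, $ij=ji$), with Euclidean norm $|Z|^2=|z_1|^2+|z_2|^2$ and Lebesgue measure $d\lambda$, and let $e_\pm=\frac{1\pm ij}{2}$, so that every $Z$ is uniquely $Z=\alpha e_++\beta e_-$ with $\alpha,\beta\in\mathbb{C}$. Put $e^{Z}=e^{\alpha}e_++e^{\beta}e_-$ and $\sqrt{Z}=\sqrt{\alpha}\,e_++\sqrt{\beta}\,e_-$ (principal branches). A function $f:\mathbb{BC}\to\mathbb{BC}$ is bicomplex holomorphic if at every $Z_0$ the quotient $(f(Z_0+H)-f(Z_0))/H$ has a limit as $H\to0$ through invertible $H$. Let $\sigma,\nu>0$ and $c_0^\sigma=(\sigma/\pi)^{1/2}$. Let $L^{2,\sigma}_{\mathbb{BC}}(\mathbb{R})$ be the space of (classes of) functions $\mathbb{R}\to\mathbb{BC}$ that are square integrable for $c_0^\sigma e^{-\sigma x^2}dx$, and let $\mathcal{F}^{2,\nu}(\mathbb{BC})$ be the space of bicomplex holomorphic functions on $\mathbb{BC}$ that are square integrable for $(\nu/\pi)^2e^{-\nu|Z|^2}d\lambda(Z)$.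 For $\psi\in L^{2,\sigma}_{\mathbb{BC}}(\mathbb{R})$ let $$\mathcal{B}\psi(Z)=c_0^\sigma\int_{\mathbb{R}}e^{-\sigma\left(x-\sqrt{\nu/(4\sigma)}\,Z\right)^2}\psi(x)\,dx ,\qquad \Gamma_\theta f(Z)=f(\theta Z).$$ Let $\theta=\theta_+e_++\theta_-e_-$ with $|\theta_+|=|\theta_-|=1$ and $1-\theta^2$ invertible, i.e. $\theta_+\neq\pm1$ and $\theta_-\neq\pm1$ (in particular $\theta\ne\pm1,\pm ij$). Consider the bicomplex fractional Fourier transform $$\mathcal{F}^\sigma_\theta\psi(y)=\frac{c_0^\sigma}{\sqrt{1-\theta^2}}\int_{\mathbb{R}}\psi(x)\,e^{-\frac{\sigma}{1-\theta^2}(x-\theta y)^2}\,dx ,$$ where, as for the Fourier transform on $L^2$, the integral is the limit in $L^{2,\sigma}_{\mathbb{BC}}(\mathbb{R})$, as $R\to\infty$, of the integrals over $[-R,R]$. Then: 1. $\mathcal{F}^\sigma_\theta$ is well defined on $L^{2,\sigma}_{\mathbb{BC}}(\mathbb{R})$: for every $\psi\in L^{2,\sigma}_{\mathbb{BC}}(\mathbb{R})$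 the integrals over $[-R,R]$ converge absolutely, define elements of $L^{2,\sigma}_{\mathbb{BC}}(\mathbb{R})$, and have a (unique) limit there as $R\to\infty$. If the integral over $\mathbb{R}$ converges absolutely for every $y$, then it equals $\mathcal{F}^\sigma_\theta\psi(y)$ for almost every $y$. 2. The integral defining $\mathcal{B}\psi(Z)$ converges absolutely for all $\psi\in L^{2,\sigma}_{\mathbb{BC}}(\mathbb{R})$ and $Z\in\mathbb{BC}$, $\mathcal{B}$ is a bijection of $L^{2,\sigma}_{\mathbb{BC}}(\mathbb{R})$ onto $\mathcal{F}^{2,\nu}(\mathbb{BC})$, and $\Gamma_\theta$ maps $\mathcal{F}^{2,\nu}(\mathbb{BC})$ into itself; and $$\mathcal{F}^\sigma_\theta\psi=\mathcal{B}^{-1}\Gamma_\theta\mathcal{B}\psi\qquad\text{for every }\psi\in L^{2,\sigma}_{\mathbb{BC}}(\mathbb{R}).$$ -/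

import Mathlib

open MeasureTheory Filter Topology

noncomputable section

/-- The bicomplex numbers `Z = z₁ + j z₂` with `z₁, z₂ : ℂ`, `j² = -1` and `ij = ji`;
`z₁ = Z.re` and `z₂ = Z.im`. -/
abbrev BC : Type := QuadraticAlgebra ℂ (-1) 0

namespace BC

/-- `Z ↦ (z₁, z₂)`, into `ℂ²` with the Euclidean norm. -/
def toL2 : BC →ₗ[ℝ] WithLp 2 (ℂ × ℂ) where
  toFun Z := WithLp.toLp 2 (Z.re, Z.im)
  map_add' _ _ := rfl
  map_smul' _ _ := rfl

theorem toL2_injective : Function.Injective toL2 := fun Z W h => by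
  have h' := congrArg WithLp.ofLp h
  exact QuadraticAlgebra.ext (congrArg Prod.fst h') (congrArg Prod.snd h')

/-- The Euclidean norm `|Z|² = |z₁|² + |z₂|²`. -/
instance : NormedAddCommGroup BC :=
  NormedAddCommGroup.induced BC (WithLp 2 (ℂ × ℂ)) toL2 toL2_injective

instance : NormedSpace ℝ BC := NormedSpace.induced ℝ BC (WithLp 2 (ℂ × ℂ)) toL2

instance : FiniteDimensional ℝ BC := Module.Finite.trans ℂ BC

instance : CompleteSpace BC := FiniteDimensional.complete ℝ BC

instance : MeasurableSpace BC := borel BC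

instance : BorelSpace BC := ⟨rfl⟩

theorem norm_eq (Z : BC) : ‖Z‖ = √(‖Z.re‖ ^ 2 + ‖Z.im‖ ^ 2) :=
  WithLp.prod_norm_eq_of_L2 (toL2 Z)

/-- The Lebesgue measure on `BC ≅ ℝ⁴`, in the coordinates `(z₁, z₂)`. -/
def lebesgue : Measure BC :=
  Measure.map (fun p : ℂ × ℂ => (⟨p.1, p.2⟩ : BC)) volume

/-- The unit `j`. -/
def j : BC := ⟨0, 1⟩

/-- The idempotent `e₊ = (1 + ij) / 2`. -/
def ePlus : BC := (1 / 2 : ℂ) • (1 + Complex.I • j)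

/-- The idempotent `e₋ = (1 - ij) / 2`. -/
def eMinus : BC := (1 / 2 : ℂ) • (1 - Complex.I • j)

/-- The first idempotent component: `Z = α e₊ + β e₋` with `α = z₁ - i z₂`. -/
def plus (Z : BC) : ℂ := Z.re - Complex.I * Z.im

/-- The second idempotent component: `Z = α e₊ + β e₋` with `β = z₁ + i z₂`. -/
def minus (Z : BC) : ℂ := Z.re + Complex.I * Z.im

theorem idempotent_decomposition (Z : BC) : Z = Z.plus • ePlus + Z.minus • eMinus := by
  ext
  · simp [plus, minus, ePlus, eMinus, j, QuadraticAlgebra.re_one]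
    ring
  · simp [plus, minus, ePlus, eMinus, j, QuadraticAlgebra.im_one]
    linear_combination Z.im * Complex.I_sq

/-- The null cone, the set of non-invertible bicomplex numbers. -/
def nullCone : Set BC := {Z | Z.re ^ 2 + Z.im ^ 2 = 0}

/-- The bicomplex exponential `e^Z = e^α e₊ + e^β e₋`. -/
def exp (Z : BC) : BC := Complex.exp Z.plus • ePlus + Complex.exp Z.minus • eMinus

/-- The principal square root `√α e₊ + √β e₋`. -/
def sqrt (Z : BC) : BC := (Z.plus ^ (1 / 2 : ℂ)) • ePlus + (Z.minus ^ (1 / 2 : ℂ)) • eMinus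

/-- The real number `x` as a bicomplex number. -/
abbrev ofReal (x : ℝ) : BC := algebraMap ℝ BC x

/-- `f` has a bicomplex derivative at every point: the difference quotient has a limit
as `H → 0` off the null cone. -/
def Holomorphic (f : BC → BC) : Prop :=
  ∀ Z₀ : BC, ∃ d : BC,
    Tendsto (fun H : BC => (f (Z₀ + H) - f Z₀) * Ring.inverse H) (𝓝[nullConeᶜ] 0) (𝓝 d)

/-- The Gaussian probability measure `(ν/π)² e^{-ν|Z|²} dλ(Z)` on `BC`. -/
def gaussian (ν : ℝ) : Measure BC :=
  lebesgue.withDensity fun Z => ENNReal.ofReal ((ν / Real.pi) ^ 2 * Real.exp (-ν * ‖Z‖ ^ 2))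

/-- The bicomplex Bargmann space `F^{2,ν}(BC)`: the bicomplex holomorphic functions on `BC`
that are square integrable for the Gaussian measure. -/
def bargmannSpace (ν : ℝ) : Set (BC → BC) :=
  {f | Holomorphic f ∧ MemLp f 2 (gaussian ν)}

/-- The normalization constant `c₀^σ = (σ/π)^{1/2}`. -/
def c₀ (σ : ℝ) : ℝ := √(σ / Real.pi)

/-- The Gaussian probability measure `c₀^σ e^{-σx²} dx` on `ℝ`. -/
def realGaussian (σ : ℝ) : Measure ℝ :=
  volume.withDensity fun x => ENNReal.ofReal (c₀ σ * Real.exp (-σ * x ^ 2))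

/-- The bicomplex Hilbert space `L^{2,σ}_BC(ℝ)`. -/
abbrev L2 (σ : ℝ) : Type := Lp BC 2 (realGaussian σ)

/-- The integrand of the Segal-Bargmann transform (without the constant `c₀^σ`),
`e^{-σ(x - √(ν/(4σ)) Z)²} φ(x)`. -/
def bargmannIntegrand (σ ν : ℝ) (φ : ℝ → BC) (Z : BC) (x : ℝ) : BC :=
  exp (-(ofReal σ * (ofReal x - ofReal √(ν / (4 * σ)) * Z) ^ 2)) * φ x

/-- The bicomplex Segal-Bargmann transform. -/
def bargmann (σ ν : ℝ) (φ : L2 σ) (Z : BC) : BC :=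
  ofReal (c₀ σ) * ∫ x : ℝ, bargmannIntegrand σ ν φ Z x

/-- The inverse of the Segal-Bargmann transform `L^{2,σ}_BC(ℝ) → F^{2,ν}(BC)`. -/
def bargmannInv (σ ν : ℝ) : (BC → BC) → L2 σ := Function.invFun (bargmann σ ν)

/-- The dilation `Γ_θ f (Z) = f (θ Z)`. -/
def dilation (θ : BC) (f : BC → BC) (Z : BC) : BC := f (θ * Z)

/-- The kernel `c₀^σ (1 - θ²)^{-1/2} e^{-σ(x - θy)²/(1 - θ²)}`. -/
def frftKernel (σ : ℝ) (θ : BC) (x y : ℝ) : BC :=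
  ofReal (c₀ σ) * Ring.inverse (sqrt (1 - θ ^ 2)) *
    exp (-(ofReal σ * Ring.inverse (1 - θ ^ 2) * (ofReal x - θ * ofReal y) ^ 2))

/-- The integral `∫ ψ(x) c₀^σ (1 - θ²)^{-1/2} e^{-σ(x - θy)²/(1 - θ²)} dx`. -/
def frftIntegral (σ : ℝ) (θ : BC) (ψ : ℝ → BC) (y : ℝ) : BC :=
  ∫ x : ℝ, ψ x * frftKernel σ θ x y

/-- `g` is the fractional Fourier transform of `ψ`: as for the Fourier transform on `L²`,
the integral over `ℝ` is the limit in mean, that is, the limit in `L^{2,σ}_BC(ℝ)` as `R → ∞` of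
the (absolutely convergent) integrals over `[-R, R]`. -/
def IsFrFT (σ : ℝ) (θ : BC) (ψ g : L2 σ) : Prop :=
  (∀ R y : ℝ, IntegrableOn (fun x => ψ x * frftKernel σ θ x y) (Set.Icc (-R) R)) ∧
  (∀ R : ℝ, MemLp (frftIntegral σ θ ((Set.Icc (-R) R).indicator ψ)) 2 (realGaussian σ)) ∧
  Tendsto (fun R : ℝ =>
      eLpNorm (frftIntegral σ θ ((Set.Icc (-R) R).indicator ψ) - ⇑g) 2 (realGaussian σ))
    atTop (𝓝 0)

open Classical in
/-- The bicomplex fractional Fourier transform `F^σ_θ` on `L^{2,σ}_BC(ℝ)`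
(with value `0` where the limit in mean does not exist). -/
def frft (σ : ℝ) (θ : BC) (ψ : L2 σ) : L2 σ :=
  if h : ∃ g, IsFrFT σ θ ψ g then h.choose else 0

end BC

end

/-! Everything splits along the idempotents. The two components of `Z` are ring homomorphisms to
`ℂ`, and a bicomplex holomorphic function is a pair of entire functions, each depending on its own
component (`Holomorphic.exists_entire`). Since `|Z|² = (|α|² + |β|²) / 2`, the Gaussian measure with
parameter `ν` is a multiple of the product of two planar Gaussian measures with parameter `ν / 2`.
The theorem thus reduces to `ℂ`-valued functions, the classical Bargmann space with parameter `ν /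
2`, and a number `θ` with `|θ| = 1`, `θ² ≠ 1`.

There, the Segal-Bargmann transform `B` is unitary. On the line `Re z = u` it is, up to explicit
factors, the Fourier transform of `ψ` times a Gaussian, so Plancherel followed by a Gaussian
integral in `u` gives the isometry (`eLpNorm_segal`). It is onto because exponentials go to
reproducing kernels, and an entire function orthogonal to all of these vanishes by the mean value
property (`exists_segal_eq`).

For the fractional transform, `|θ| = 1` forces `1 / (1 - θ²)` to have real part `1 / 2` and `θ / (1
- θ²)` to be imaginary (`exists_inv_one_sub_sq`). Hence the transform is a chirp, a Fourier
transform, a dilation and a second chirp, and Plancherel gives the limit in mean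
(`exists_tendsto_fracIntegral`). For truncated `ψ`, Fubini and one Gaussian integral give `B F_θ ψ
(z) = B ψ (θ z)`; point evaluations of `B` are bounded, so the identity survives the limit.
Injectivity of `B` then yields both the uniqueness of the limit and the formula `F_θ = B⁻¹ Γ_θ B`.
-/

noncomputable section

namespace Bargmann

open FourierTransform ContDiff SchwartzMap BC

/-! ### Plancherel for the Fourier integral, and truncation in `L²` -/

/-- On `L¹ ∩ L²` the Fourier transform of `L²` is given by the Fourier integral. -/
theorem fourier_toLp_ae_eq {f : ℝ → ℂ} (h1 : Integrable f) (h2 : MemLp f 2 volume) :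
    (𝓕 (h2.toLp f) : Lp ℂ 2 (volume : Measure ℝ)) =ᵐ[volume] 𝓕 f := by
  have hcont : Continuous (𝓕 f) :=
    VectorFourier.fourierIntegral_continuous Real.continuous_fourierChar
      (by exact continuous_inner) h1
  refine ae_eq_of_integral_contDiff_smul_eq ?_ hcont.locallyIntegrable ?_
  · exact (Lp.memLp _).locallyIntegrable (by norm_num)
  intro φ hφ hφc
  have hc : HasCompactSupport (fun x => (φ x : ℂ)) :=
    hφc.comp_left (g := fun t : ℝ => (t : ℂ)) Complex.ofReal_zero
  let Φ : 𝓢(ℝ, ℂ) := hc.toSchwartzMap (Complex.ofRealCLM.contDiff.comp hφ)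
  have hΦ : ∀ x, Φ x = (φ x : ℂ) := fun _ => rfl
  -- The `L²` transform is compatible with the distributional one, so its pairing with a test
  -- function moves the Fourier transform onto the test function; the same exchange holds for the
  -- integral by Fubini.
  have key := congrArg (fun T => T Φ) (Lp.fourier_toTemperedDistribution_eq (h2.toLp f))
  simp only [TemperedDistribution.fourier_apply, Lp.toTemperedDistribution_apply] at key
  have e1 : ∫ x, (𝓕 Φ) x • (h2.toLp f) x = ∫ x, (𝓕 (Φ : ℝ → ℂ)) x • f x := by
    refine integral_congr_ae ?_
    filter_upwards [h2.coeFn_toLp] with x hx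
    rw [hx, SchwartzMap.fourier_coe]
  have e2 := VectorFourier.integral_fourierIntegral_smul_eq_flip (L := innerₗ ℝ)
      Real.continuous_fourierChar continuous_inner (Φ.integrable (μ := volume)) h1
  have e3 : ∫ x, (𝓕 (Φ : ℝ → ℂ)) x • f x = ∫ x, Φ x • 𝓕 f x := by
    simpa using! e2
  rw [e1, e3] at key
  simpa [hΦ] using key.symm

theorem eLpNorm_two_sq {α E : Type*} [MeasurableSpace α] [NormedAddCommGroup E] (f : α → E)
    (μ : Measure α) : eLpNorm f 2 μ ^ 2 = ∫⁻ x, ‖f x‖ₑ ^ 2 ∂μ := by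
  have := eLpNorm_nnreal_pow_eq_lintegral (f := f) (μ := μ) (p := 2) two_ne_zero
  simpa using this

/-- Plancherel's theorem for the Fourier integral on `L¹ ∩ L²`. -/
theorem eLpNorm_fourier_eq {f : ℝ → ℂ} (h1 : Integrable f) (h2 : MemLp f 2 volume) :
    eLpNorm (𝓕 f) 2 volume = eLpNorm f 2 volume := by
  rw [← eLpNorm_congr_ae (fourier_toLp_ae_eq h1 h2), ← eLpNorm_congr_ae h2.coeFn_toLp]
  have := Lp.norm_fourier_eq (h2.toLp f)
  rwa [Lp.norm_def, Lp.norm_def, ENNReal.toReal_eq_toReal_iff' (Lp.eLpNorm_ne_top _)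
    (Lp.eLpNorm_ne_top _)] at this

theorem lintegral_comp_mul_left {k : ℝ} (hk : k ≠ 0) (f : ℝ → ENNReal) :
    ∫⁻ x, f (k * x) = ENNReal.ofReal |k⁻¹| * ∫⁻ x, f x := by
  have h := lintegral_map_equiv (μ := (volume : Measure ℝ)) f
    (MeasurableEquiv.mulLeft₀ k hk)
  rw [MeasurableEquiv.coe_mulLeft₀, Real.map_volume_mul_left hk, lintegral_smul_measure] at h
  exact h.symm

/-- Truncations converge in `L²`. -/
theorem tendsto_eLpNorm_indicator_sub {E : Type*} [NormedAddCommGroup E] {μ : Measure ℝ}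
    {f : ℝ → E} (hf : MemLp f 2 μ) :
    Tendsto (fun R : ℝ => eLpNorm ((Set.Icc (-R) R).indicator f - f) 2 μ) atTop (𝓝 0) := by
  have key : Tendsto (fun R : ℝ => ∫⁻ x, ‖((Set.Icc (-R) R).indicator f - f) x‖ₑ ^ 2 ∂μ)
      atTop (𝓝 (∫⁻ _, 0 ∂μ)) := by
    have hfin : ∫⁻ x, ‖f x‖ₑ ^ 2 ∂μ ≠ ⊤ := by
      rw [← eLpNorm_two_sq]; exact ENNReal.pow_ne_top hf.eLpNorm_ne_top
    refine tendsto_lintegral_filter_of_dominated_convergence' (fun x => ‖f x‖ₑ ^ 2) ?_ ?_ hfin ?_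
    · refine Eventually.of_forall fun R => ?_
      exact (((hf.1.indicator measurableSet_Icc).sub hf.1).enorm.pow_const 2)
    · refine Eventually.of_forall fun R => Eventually.of_forall fun x => ?_
      by_cases hx : x ∈ Set.Icc (-R) R <;> simp [hx]
    · refine Eventually.of_forall fun x => ?_
      refine tendsto_const_nhds.congr' ?_
      filter_upwards [eventually_ge_atTop |x|] with R hR
      have hx : x ∈ Set.Icc (-R) R := by rwa [Set.mem_Icc, ← abs_le]
      simp [hx]
  rw [lintegral_zero] at key
  have h2 := (ENNReal.continuous_rpow_const (y := (1 / 2 : ℝ))).tendsto 0 |>.comp key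
  rw [ENNReal.zero_rpow_of_pos (by norm_num)] at h2
  refine h2.congr fun R => ?_
  simp only [Function.comp]
  rw [← eLpNorm_two_sq, ← ENNReal.rpow_natCast, ← ENNReal.rpow_mul]
  norm_num

/-! ### The Gaussian weight on the line -/

theorem c₀_pos {σ : ℝ} (hσ : 0 < σ) : 0 < c₀ σ := Real.sqrt_pos.2 (div_pos hσ Real.pi_pos)

theorem measurable_realGaussian_density (σ : ℝ) :
    Measurable fun x : ℝ => ENNReal.ofReal (c₀ σ * Real.exp (-σ * x ^ 2)) := by
  fun_prop

theorem lintegral_realGaussian (σ : ℝ) (f : ℝ → ENNReal) :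
    ∫⁻ x, f x ∂realGaussian σ =
      ∫⁻ x, ENNReal.ofReal (c₀ σ * Real.exp (-σ * x ^ 2)) * f x :=
  lintegral_withDensity_eq_lintegral_mul_non_measurable _ (measurable_realGaussian_density σ)
    (Eventually.of_forall fun _ => ENNReal.ofReal_lt_top) _

theorem realGaussian_absolutelyContinuous (σ : ℝ) : realGaussian σ ≪ volume :=
  withDensity_absolutelyContinuous _ _

theorem volume_absolutelyContinuous_realGaussian {σ : ℝ} (hσ : 0 < σ) :
    volume ≪ realGaussian σ := by
  refine withDensity_absolutelyContinuous' (measurable_realGaussian_density σ).aemeasurable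
    (Eventually.of_forall fun x => ?_)
  have := c₀_pos hσ
  simp only [ne_eq, ENNReal.ofReal_eq_zero, not_le]
  positivity

/-- `L²` for the Gaussian measure is `L²` for the Lebesgue measure, up to the square root of the
density. -/
theorem eLpNorm_realGaussian_sq {σ : ℝ} (hσ : 0 < σ) (f : ℝ → ℂ) {w : ℝ → ℂ}
    (hw : ∀ x, ‖w x‖ = Real.exp (-(σ / 2) * x ^ 2)) :
    eLpNorm f 2 (realGaussian σ) ^ 2 =
      ENNReal.ofReal (c₀ σ) * eLpNorm (fun x => w x * f x) 2 volume ^ 2 := by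
  rw [eLpNorm_two_sq, eLpNorm_two_sq, lintegral_realGaussian,
    ← lintegral_const_mul' _ _ ENNReal.ofReal_ne_top]
  refine lintegral_congr fun x => ?_
  rw [enorm_mul, mul_pow, ← mul_assoc, ENNReal.ofReal_mul (c₀_pos hσ).le]
  congr 2
  rw [← ofReal_norm, hw, ← ENNReal.ofReal_pow (Real.exp_nonneg _), ← Real.exp_nat_mul]
  congr 2; push_cast; ring

theorem memLp_weight_mul {σ : ℝ} (hσ : 0 < σ) {f : ℝ → ℂ} (hf : MemLp f 2 (realGaussian σ))
    {w : ℝ → ℂ} (hwc : Continuous w) (hw : ∀ x, ‖w x‖ = Real.exp (-(σ / 2) * x ^ 2)) :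
    MemLp (fun x => w x * f x) 2 volume := by
  refine ⟨hwc.aestronglyMeasurable.mul
    (hf.1.mono_ac (volume_absolutelyContinuous_realGaussian hσ)), ?_⟩
  have h := eLpNorm_realGaussian_sq hσ f hw
  by_contra hcon
  rw [not_lt, top_le_iff] at hcon
  rw [hcon] at h
  have h1 : ENNReal.ofReal (c₀ σ) ≠ 0 := by simpa using c₀_pos hσ
  rw [ENNReal.top_pow two_ne_zero, ENNReal.mul_top h1] at h
  exact ENNReal.pow_ne_top hf.eLpNorm_ne_top h

/-! ### The one-variable Segal-Bargmann transform: convergence and bounded point evaluations -/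

/-- The Segal-Bargmann transform on `ℂ`-valued functions, with dilation parameter `a`. -/
def segal (σ a : ℝ) (ψ : ℝ → ℂ) (z : ℂ) : ℂ :=
  c₀ σ * ∫ x : ℝ, Complex.exp (-(σ * (x - a * z) ^ 2)) * ψ x

theorem norm_gaussian_shift (σ a : ℝ) (z : ℂ) (x : ℝ) :
    ‖Complex.exp (-(σ * (x - a * z) ^ 2))‖ =
      Real.exp (σ * a ^ 2 * z.im ^ 2) * Real.exp (-σ * (x - a * z.re) ^ 2) := by
  rw [Complex.norm_exp, ← Real.exp_add]
  congr 1
  simp [pow_two]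
  ring

theorem integrable_gaussian_shift_mul {σ : ℝ} (hσ : 0 < σ) (a : ℝ) {ψ : ℝ → ℂ}
    (hψ : MemLp ψ 2 (realGaussian σ)) (z : ℂ) :
    Integrable fun x : ℝ => Complex.exp (-(σ * (x - a * z) ^ 2)) * ψ x := by
  have h1 : MemLp (fun x : ℝ => Complex.exp (-(σ / 2 : ℝ) * x ^ 2) * ψ x) 2 volume :=
    memLp_weight_mul hσ hψ (by fun_prop) fun x => by
      rw [Complex.norm_exp]; congr 1; simp [pow_two]
  have h2 : MemLp (fun x : ℝ => Complex.exp (-(σ / 2 : ℝ) * x ^ 2 + (2 * σ * a * z) * x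
      + (-σ * a ^ 2 * z ^ 2))) 2 volume := by
    rw [memLp_two_iff_integrable_sq_norm (by fun_prop)]
    have := (integrable_cexp_quadratic (b := σ) (by simpa using hσ)
      (4 * σ * a * z) (-2 * σ * a ^ 2 * z ^ 2)).norm
    refine this.congr (Eventually.of_forall fun x => ?_)
    simp only
    rw [← norm_pow, ← Complex.exp_nat_mul]
    congr 2; push_cast; ring
  refine (h2.integrable_mul h1).congr (Eventually.of_forall fun x => ?_)
  simp only [Pi.mul_apply]
  rw [← mul_assoc, ← Complex.exp_add]
  congr 2; push_cast; ring

/-- The Segal-Bargmann transform as the integral of an exponential family. -/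
theorem segal_eq_integral_realGaussian {σ : ℝ} (hσ : 0 < σ) (a : ℝ) (ψ : ℝ → ℂ) (z : ℂ) :
    segal σ a ψ z =
      ∫ x, Complex.exp (2 * σ * a * z * x - σ * a ^ 2 * z ^ 2) * ψ x ∂realGaussian σ := by
  rw [realGaussian, integral_withDensity_eq_integral_toReal_smul
    (measurable_realGaussian_density σ) (Eventually.of_forall fun _ => ENNReal.ofReal_lt_top),
    segal, ← integral_const_mul]
  refine integral_congr_ae (Eventually.of_forall fun x => ?_)
  simp only
  rw [ENNReal.toReal_ofReal (mul_nonneg (c₀_pos hσ).le (Real.exp_nonneg _)), Complex.real_smul]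
  push_cast
  rw [mul_assoc, ← mul_assoc (Complex.exp _) (Complex.exp _), ← Complex.exp_add]
  congr 3
  ring

theorem memLp_exp_linear {σ : ℝ} (hσ : 0 < σ) (b c : ℂ) :
    MemLp (fun x : ℝ => Complex.exp (b * x - c)) 2 (realGaussian σ) := by
  have hm : AEStronglyMeasurable (fun x : ℝ => Complex.exp (b * x - c)) (realGaussian σ) := by
    fun_prop
  refine ⟨hm, ?_⟩
  have h := eLpNorm_realGaussian_sq hσ (fun x : ℝ => Complex.exp (b * x - c))
    (w := fun x => Complex.exp (-(σ / 2 : ℝ) * x ^ 2)) fun x => by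
      rw [Complex.norm_exp]; congr 1; simp [pow_two]
  have h2 : MemLp (fun x : ℝ => Complex.exp (-(σ / 2 : ℝ) * x ^ 2) * Complex.exp (b * x - c))
      2 volume := by
    rw [memLp_two_iff_integrable_sq_norm (by fun_prop)]
    have := (integrable_cexp_quadratic (b := σ) (by simpa using hσ) (2 * b) (-2 * c)).norm
    refine this.congr (Eventually.of_forall fun x => ?_)
    simp only
    rw [← norm_pow, ← Complex.exp_add, ← Complex.exp_nat_mul]
    congr 2; push_cast; ring
  by_contra hcon
  rw [not_lt, top_le_iff] at hcon
  rw [hcon, ENNReal.top_pow two_ne_zero] at h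
  exact ENNReal.mul_ne_top ENNReal.ofReal_ne_top (ENNReal.pow_ne_top h2.eLpNorm_ne_top) h.symm

/-- Point evaluations of the Segal-Bargmann transform are bounded on `L²`. -/
theorem exists_enorm_segal_le {σ : ℝ} (hσ : 0 < σ) (a : ℝ) (z : ℂ) :
    ∃ C : ENNReal, C ≠ ⊤ ∧ ∀ ψ : ℝ → ℂ, MemLp ψ 2 (realGaussian σ) →
      ‖segal σ a ψ z‖ₑ ≤ C * eLpNorm ψ 2 (realGaussian σ) := by
  let k : ℝ → ℂ := fun x => Complex.exp (2 * σ * a * z * x - σ * a ^ 2 * z ^ 2)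
  have hk : MemLp k 2 (realGaussian σ) :=
    memLp_exp_linear hσ (2 * σ * a * z) (σ * a ^ 2 * z ^ 2)
  refine ⟨eLpNorm k 2 (realGaussian σ), hk.eLpNorm_ne_top, fun ψ hψ => ?_⟩
  have h := eLpNorm_smul_le_mul_eLpNorm (p := 2) (q := 2) (r := 1) hψ.1 hk.1
  rw [eLpNorm_one_eq_lintegral_enorm] at h
  rw [segal_eq_integral_realGaussian hσ]
  exact (enorm_integral_le_lintegral_enorm _).trans h

theorem segal_sub {σ : ℝ} (hσ : 0 < σ) (a : ℝ) {ψ φ : ℝ → ℂ}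
    (hψ : MemLp ψ 2 (realGaussian σ)) (hφ : MemLp φ 2 (realGaussian σ)) (z : ℂ) :
    segal σ a (ψ - φ) z = segal σ a ψ z - segal σ a φ z := by
  simp only [segal, Pi.sub_apply, mul_sub]
  rw [integral_sub (integrable_gaussian_shift_mul hσ a hψ z)
    (integrable_gaussian_shift_mul hσ a hφ z), mul_sub]

theorem segal_congr {σ a : ℝ} (hσ : 0 < σ) {ψ φ : ℝ → ℂ} (h : ψ =ᵐ[realGaussian σ] φ) :
    segal σ a ψ = segal σ a φ := by
  funext z
  rw [segal_eq_integral_realGaussian hσ, segal_eq_integral_realGaussian hσ]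
  refine integral_congr_ae ?_
  filter_upwards [h] with x hx
  rw [hx]

/-- Bounded point evaluations turn convergence in mean into pointwise convergence of the transforms;
this carries the intertwining identity from truncations to all of `L²`. -/
theorem tendsto_segal {σ : ℝ} (hσ : 0 < σ) (a : ℝ) {ι : Type*} {l : Filter ι}
    {F : ι → ℝ → ℂ} {ψ : ℝ → ℂ} (hF : ∀ i, MemLp (F i) 2 (realGaussian σ))
    (hψ : MemLp ψ 2 (realGaussian σ))
    (h : Tendsto (fun i => eLpNorm (F i - ψ) 2 (realGaussian σ)) l (𝓝 0)) (z : ℂ) :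
    Tendsto (fun i => segal σ a (F i) z) l (𝓝 (segal σ a ψ z)) := by
  obtain ⟨C, hC, hle⟩ := exists_enorm_segal_le hσ a z
  rw [tendsto_iff_edist_tendsto_0]
  have h0 : Tendsto (fun i => C * eLpNorm (F i - ψ) 2 (realGaussian σ)) l (𝓝 0) := by
    simpa using ENNReal.Tendsto.const_mul h (Or.inr hC)
  refine tendsto_of_tendsto_of_tendsto_of_le_of_le tendsto_const_nhds h0 (fun _ => zero_le)
    fun i => ?_
  simp only [edist_eq_enorm_sub]
  rw [← segal_sub hσ a (hF i) hψ]
  exact hle _ ((hF i).sub hψ)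

/-! ### The one-variable fractional Fourier transform -/

/-- The kernel of the fractional Fourier transform on `ℂ`-valued functions. -/
def fracKernel (σ : ℝ) (θ : ℂ) (x y : ℝ) : ℂ :=
  c₀ σ * ((1 - θ ^ 2) ^ (1 / 2 : ℂ))⁻¹ * Complex.exp (-(σ * (1 - θ ^ 2)⁻¹ * (x - θ * y) ^ 2))

/-- The integral defining the fractional Fourier transform on `ℂ`-valued functions. -/
def fracIntegral (σ : ℝ) (θ : ℂ) (ψ : ℝ → ℂ) (y : ℝ) : ℂ :=
  ∫ x : ℝ, ψ x * fracKernel σ θ x y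

/-- On the unit circle `conj θ = θ⁻¹`, so `w = 1 / (1 - θ²)` satisfies `conj w = 1 - w`, while `θ w
= 1 / (conj θ - θ)` is the inverse of an imaginary number. This is the only way `|θ| = 1` enters the
analysis of the kernel. -/
theorem exists_inv_one_sub_sq {θ : ℂ} (hθ : ‖θ‖ = 1) (h1 : 1 - θ ^ 2 ≠ 0) :
    ∃ τ κ : ℝ, κ ≠ 0 ∧ (1 - θ ^ 2)⁻¹ = 1 / 2 + τ * Complex.I ∧
      θ * (1 - θ ^ 2)⁻¹ = κ * Complex.I := by
  have hθ0 : θ ≠ 0 := by rintro rfl; simp at hθ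
  have hconj : (starRingEnd ℂ) θ = θ⁻¹ := by
    rw [Complex.inv_def, Complex.normSq_eq_norm_sq, hθ]; simp
  set w := (1 - θ ^ 2)⁻¹ with hw
  have hwc : (starRingEnd ℂ) w = 1 - w := by
    rw [hw, map_inv₀, map_sub, map_pow, map_one, hconj]
    have h2 : 1 - (θ⁻¹) ^ 2 ≠ 0 := by
      intro h
      apply h1
      field_simp at h
      linear_combination -h
    have h3 : θ ^ 2 - 1 ≠ 0 := by intro h; apply h1; linear_combination -h
    field_simp
    ring
  have hre : w.re = 1 / 2 := by
    have := congrArg Complex.re hwc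
    simp at this
    linarith
  have hθw : (starRingEnd ℂ) (θ * w) = -(θ * w) := by
    rw [map_mul, hwc, hconj, hw]
    field_simp
    ring
  have hre2 : (θ * w).re = 0 := by
    have := congrArg Complex.re hθw
    simp only [Complex.conj_re, Complex.neg_re] at this
    linarith
  refine ⟨w.im, (θ * w).im, ?_, ?_, ?_⟩
  · intro h
    have : θ * w = 0 := Complex.ext hre2 h
    exact mul_ne_zero hθ0 (inv_ne_zero h1) this
  · conv_lhs => rw [← Complex.re_add_im w, hre]
    push_cast; rfl
  · conv_lhs => rw [← Complex.re_add_im (θ * w), hre2]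
    simp

/-- The modulus of the kernel separates: the real part contributes `-σx²/2`, the square root of the
Gaussian density, and `+σy²/2`, which that same weight cancels on the target side. The cross term is
purely oscillatory, hence a Fourier kernel. -/
theorem fracKernel_exponent {θ : ℂ} {τ κ : ℝ} (h1 : 1 - θ ^ 2 ≠ 0)
    (hτ : (1 - θ ^ 2)⁻¹ = 1 / 2 + τ * Complex.I) (hκ : θ * (1 - θ ^ 2)⁻¹ = κ * Complex.I)
    (σ x y : ℝ) :
    -(σ * (1 - θ ^ 2)⁻¹ * (x - θ * y) ^ 2) =
      -σ * (1 / 2 + τ * Complex.I) * x ^ 2 + (2 * σ * κ * Complex.I) * x * y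
        - σ * (-1 / 2 + τ * Complex.I) * y ^ 2 := by
  have h3 : θ ^ 2 * (1 - θ ^ 2)⁻¹ = -1 / 2 + τ * Complex.I := by
    have : θ ^ 2 * (1 - θ ^ 2)⁻¹ = (1 - θ ^ 2)⁻¹ - 1 := by field_simp; ring
    rw [this, hτ]; ring
  linear_combination (-(σ : ℂ) * x ^ 2) * hτ + (2 * σ * x * y) * hκ - (σ * y ^ 2) * h3

/-- The chirp weight in the domain of the fractional Fourier transform. -/
def chirp (σ τ : ℝ) (x : ℝ) : ℂ := Complex.exp (-σ * (1 / 2 + τ * Complex.I) * x ^ 2)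

theorem continuous_chirp (σ τ : ℝ) : Continuous (chirp σ τ) := by unfold chirp; fun_prop

theorem norm_chirp (σ τ x : ℝ) : ‖chirp σ τ x‖ = Real.exp (-(σ / 2) * x ^ 2) := by
  rw [chirp, Complex.norm_exp]; congr 1; simp [pow_two]; left; ring

/-- Dilation and multiplication by a chirp, taking the Fourier transform to the fractional
Fourier transform. -/
def chirpDilation (σ : ℝ) (θ : ℂ) (τ κ : ℝ) (F : ℝ → ℂ) (y : ℝ) : ℂ :=
  c₀ σ * ((1 - θ ^ 2) ^ (1 / 2 : ℂ))⁻¹ * Complex.exp (-σ * (-1 / 2 + τ * Complex.I) * y ^ 2) *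
    F (-(σ * κ / Real.pi) * y)

theorem fracIntegral_eq {θ : ℂ} {τ κ : ℝ} (h1 : 1 - θ ^ 2 ≠ 0)
    (hτ : (1 - θ ^ 2)⁻¹ = 1 / 2 + τ * Complex.I) (hκ : θ * (1 - θ ^ 2)⁻¹ = κ * Complex.I)
    (σ : ℝ) (ψ : ℝ → ℂ) :
    fracIntegral σ θ ψ = chirpDilation σ θ τ κ (𝓕 fun x => chirp σ τ x * ψ x) := by
  funext y
  rw [fracIntegral, chirpDilation, Real.fourier_real_eq_integral_exp_smul, ← integral_const_mul]
  refine integral_congr_ae (Eventually.of_forall fun x => ?_)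
  simp only [fracKernel, chirp, smul_eq_mul]
  rw [fracKernel_exponent h1 hτ hκ]
  -- The frequency `-(σκ/π) y` is the one for which `-2πxξ` equals `2σκxy`.
  have e : -σ * (1 / 2 + τ * Complex.I) * x ^ 2 + (2 * σ * κ * Complex.I) * x * y
        - σ * (-1 / 2 + τ * Complex.I) * y ^ 2 =
      -σ * (-1 / 2 + τ * Complex.I) * y ^ 2 +
      (↑(-2 * Real.pi * x * (-(σ * κ / Real.pi) * y)) * Complex.I +
      -σ * (1 / 2 + τ * Complex.I) * x ^ 2) := by
    have : (Real.pi : ℂ) ≠ 0 := by exact_mod_cast Real.pi_ne_zero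
    push_cast
    field_simp
    ring
  rw [e, Complex.exp_add, Complex.exp_add]
  ring

theorem chirpDilation_sub (σ : ℝ) (θ : ℂ) (τ κ : ℝ) (F G : ℝ → ℂ) :
    chirpDilation σ θ τ κ (F - G) = chirpDilation σ θ τ κ F - chirpDilation σ θ τ κ G := by
  funext y
  simp only [chirpDilation, Pi.sub_apply, mul_sub]

/-- `chirpDilation` is a multiple of an isometry `L²(ℝ) → L²(realGaussian σ)`. -/
theorem exists_eLpNorm_chirpDilation {σ : ℝ} (hσ : 0 < σ) (θ : ℂ) (τ : ℝ) {κ : ℝ} (hκ : κ ≠ 0) :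
    ∃ K : ENNReal, K ≠ ⊤ ∧ ∀ F : ℝ → ℂ,
      eLpNorm (chirpDilation σ θ τ κ F) 2 (realGaussian σ) ^ 2 = K * eLpNorm F 2 volume ^ 2 := by
  have hk : -(σ * κ / Real.pi) ≠ 0 :=
    neg_ne_zero.2 (div_ne_zero (mul_ne_zero hσ.ne' hκ) Real.pi_ne_zero)
  set k := -(σ * κ / Real.pi)
  set A : ℂ := c₀ σ * ((1 - θ ^ 2) ^ (1 / 2 : ℂ))⁻¹ with hA
  refine ⟨ENNReal.ofReal (c₀ σ) * (‖A‖ₑ ^ 2 * ENNReal.ofReal |k⁻¹|), by finiteness, fun F => ?_⟩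
  rw [eLpNorm_realGaussian_sq hσ _ (w := chirp σ τ) (norm_chirp σ τ), mul_assoc, mul_assoc,
    eLpNorm_two_sq, eLpNorm_two_sq, ← lintegral_comp_mul_left hk,
    ← lintegral_const_mul' (‖A‖ₑ ^ 2) _ (by finiteness)]
  congr 1
  refine lintegral_congr fun y => ?_
  rw [← mul_pow, ← enorm_mul]
  congr 1
  have hn : ‖chirp σ τ y * chirpDilation σ θ τ κ F y‖ = ‖A * F (k * y)‖ := by
    -- The real parts `-σ/2` and `+σ/2` of the two quadratic exponents cancel, leaving a phase.
    have hu : ‖chirp σ τ y * Complex.exp (-σ * (-1 / 2 + τ * Complex.I) * y ^ 2)‖ = 1 := by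
      rw [chirp, ← Complex.exp_add]
      convert! Complex.norm_exp_ofReal_mul_I (-2 * σ * τ * y ^ 2) using 3
      push_cast; ring
    simp only [chirpDilation]
    rw [← hA, ← one_mul ‖A * _‖, ← hu, ← norm_mul]
    congr 1
    ring
  rw [← ofReal_norm, ← ofReal_norm, hn]

theorem aestronglyMeasurable_chirpDilation {σ : ℝ} (hσ : 0 < σ) (θ : ℂ) (τ : ℝ) {κ : ℝ}
    (hκ : κ ≠ 0) {F : ℝ → ℂ} (hF : AEStronglyMeasurable F volume) :
    AEStronglyMeasurable (chirpDilation σ θ τ κ F) (realGaussian σ) := by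
  have hk : -(σ * κ / Real.pi) ≠ 0 :=
    neg_ne_zero.2 (div_ne_zero (mul_ne_zero hσ.ne' hκ) Real.pi_ne_zero)
  refine AEStronglyMeasurable.mono_ac (realGaussian_absolutelyContinuous σ) ?_
  unfold chirpDilation
  refine AEStronglyMeasurable.mul (by fun_prop) ?_
  refine hF.comp_quasiMeasurePreserving ⟨by fun_prop, ?_⟩
  rw [Real.map_volume_mul_left hk]
  exact Measure.smul_absolutelyContinuous

theorem memLp_chirpDilation {σ : ℝ} (hσ : 0 < σ) (θ : ℂ) (τ : ℝ) {κ : ℝ}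
    (hκ : κ ≠ 0) {F : ℝ → ℂ} (hF : MemLp F 2 volume) :
    MemLp (chirpDilation σ θ τ κ F) 2 (realGaussian σ) := by
  refine ⟨aestronglyMeasurable_chirpDilation hσ θ τ hκ hF.1, ?_⟩
  obtain ⟨K, hK, h⟩ := exists_eLpNorm_chirpDilation hσ θ τ hκ
  have h' := h F
  by_contra hcon
  rw [not_lt, top_le_iff] at hcon
  rw [hcon, ENNReal.top_pow two_ne_zero] at h'
  exact ENNReal.mul_ne_top hK (ENNReal.pow_ne_top hF.eLpNorm_ne_top) h'.symm

theorem integrable_indicator_of_memLp {f : ℝ → ℂ} (hf : MemLp f 2 volume) (R : ℝ) :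
    Integrable ((Set.Icc (-R) R).indicator f) := by
  rw [integrable_indicator_iff measurableSet_Icc]
  exact (hf.mono_measure Measure.restrict_le_self).integrable (by norm_num)

/-- On a compact interval the Gaussian weight is bounded below, so `ψ` is integrable there, and the
kernel is continuous in `x`. -/
theorem integrableOn_mul_fracKernel {σ : ℝ} (hσ : 0 < σ) (θ : ℂ)
    {ψ : ℝ → ℂ} (hψ : MemLp ψ 2 (realGaussian σ)) (R y : ℝ) :
    IntegrableOn (fun x => ψ x * fracKernel σ θ x y) (Set.Icc (-R) R) := by
  have hloc : IntegrableOn ψ (Set.Icc (-R) R) := by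
    have h := memLp_weight_mul hσ hψ (continuous_chirp σ 0) (norm_chirp σ 0)
    have h2 : IntegrableOn (fun x => chirp σ 0 x * ψ x) (Set.Icc (-R) R) :=
      (h.mono_measure Measure.restrict_le_self).integrable (by norm_num)
    have hc : ContinuousOn (fun x => (chirp σ 0 x)⁻¹) (Set.Icc (-R) R) :=
      ((continuous_chirp σ 0).inv₀ fun x => Complex.exp_ne_zero _).continuousOn
    refine (h2.continuousOn_mul hc isCompact_Icc).congr_fun (fun x _ => ?_) measurableSet_Icc
    exact inv_mul_cancel_left₀ (Complex.exp_ne_zero _) _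
  refine hloc.mul_continuousOn ?_ isCompact_Icc
  unfold fracKernel
  fun_prop

/-- The fractional Fourier transform as a limit in mean. -/
theorem exists_tendsto_fracIntegral {σ : ℝ} (hσ : 0 < σ) {θ : ℂ} (hθ : ‖θ‖ = 1)
    (h1 : 1 - θ ^ 2 ≠ 0) {ψ : ℝ → ℂ} (hψ : MemLp ψ 2 (realGaussian σ)) :
    (∀ R : ℝ, MemLp (fracIntegral σ θ ((Set.Icc (-R) R).indicator ψ)) 2 (realGaussian σ)) ∧
    ∃ g : ℝ → ℂ, MemLp g 2 (realGaussian σ) ∧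
      Tendsto (fun R : ℝ => eLpNorm (fracIntegral σ θ ((Set.Icc (-R) R).indicator ψ) - g) 2
        (realGaussian σ)) atTop (𝓝 0) := by
  obtain ⟨τ, κ, hκ0, hτ, hκ⟩ := exists_inv_one_sub_sq hθ h1
  set h : ℝ → ℂ := fun x => chirp σ τ x * ψ x with hh
  have hL : MemLp h 2 volume := memLp_weight_mul hσ hψ (continuous_chirp σ τ) (norm_chirp σ τ)
  have hLR : ∀ R : ℝ, MemLp ((Set.Icc (-R) R).indicator h) 2 volume :=
    fun R => hL.indicator measurableSet_Icc
  have hI := integrable_indicator_of_memLp hL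
  have hT : ∀ R : ℝ, fracIntegral σ θ ((Set.Icc (-R) R).indicator ψ) =
      chirpDilation σ θ τ κ (𝓕 ((Set.Icc (-R) R).indicator h)) := by
    intro R
    rw [fracIntegral_eq h1 hτ hκ]
    congr 2
    funext x
    by_cases hx : x ∈ Set.Icc (-R) R <;> simp [hx, hh]
  have hF : ∀ R : ℝ, MemLp (𝓕 ((Set.Icc (-R) R).indicator h)) 2 volume := fun R =>
    (memLp_congr_ae (fourier_toLp_ae_eq (hI R) (hLR R))).1 (Lp.memLp _)
  -- The candidate limit comes from the `L²` Fourier transform of the full chirped function, whose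
  -- Fourier integral need not converge.
  let G : Lp ℂ 2 (volume : Measure ℝ) := 𝓕 (hL.toLp h)
  refine ⟨fun R => ?_, chirpDilation σ θ τ κ G, memLp_chirpDilation hσ θ τ hκ0 (Lp.memLp G), ?_⟩
  · rw [hT]
    exact memLp_chirpDilation hσ θ τ hκ0 (hF R)
  · obtain ⟨K, hK, hiso⟩ := exists_eLpNorm_chirpDilation hσ θ τ hκ0
    have hdist : ∀ R : ℝ, eLpNorm (𝓕 ((Set.Icc (-R) R).indicator h) - ⇑G) 2 volume =
        eLpNorm ((Set.Icc (-R) R).indicator h - h) 2 volume := by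
      intro R
      have e1 : (𝓕 ((Set.Icc (-R) R).indicator h) - ⇑G) =ᵐ[volume]
          (𝓕 ((hLR R).toLp _ - hL.toLp h) : Lp ℂ 2 (volume : Measure ℝ)) := by
        have e2 : (𝓕 ((hLR R).toLp _ - hL.toLp h) : Lp ℂ 2 (volume : Measure ℝ)) =
            𝓕 ((hLR R).toLp _) - G := map_sub (Lp.fourierTransformₗᵢ ℝ ℂ) _ _
        rw [e2]
        filter_upwards [fourier_toLp_ae_eq (hI R) (hLR R), Lp.coeFn_sub (𝓕 ((hLR R).toLp _)) G]
          with x hx hx2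
        rw [hx2, Pi.sub_apply, Pi.sub_apply, hx]
      rw [eLpNorm_congr_ae e1]
      have e3 := Lp.norm_fourier_eq ((hLR R).toLp _ - hL.toLp h)
      rw [Lp.norm_def, Lp.norm_def, ENNReal.toReal_eq_toReal_iff' (Lp.eLpNorm_ne_top _)
        (Lp.eLpNorm_ne_top _)] at e3
      rw [e3]
      refine eLpNorm_congr_ae ?_
      filter_upwards [Lp.coeFn_sub ((hLR R).toLp _) (hL.toLp h), (hLR R).coeFn_toLp,
        hL.coeFn_toLp] with x a b c
      rw [a, Pi.sub_apply, Pi.sub_apply, b, c]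
    have hlim := tendsto_eLpNorm_indicator_sub hL
    have h2 : Tendsto (fun R : ℝ => K * eLpNorm ((Set.Icc (-R) R).indicator h - h) 2 volume ^ 2)
        atTop (𝓝 0) := by
      simpa using ENNReal.Tendsto.const_mul (ENNReal.Tendsto.pow (n := 2) hlim) (Or.inr hK)
    have h3 : Tendsto (fun R : ℝ => eLpNorm (fracIntegral σ θ ((Set.Icc (-R) R).indicator ψ) -
        chirpDilation σ θ τ κ G) 2 (realGaussian σ) ^ 2) atTop (𝓝 0) := by
      refine h2.congr fun R => ?_
      rw [hT, ← chirpDilation_sub, hiso, hdist]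
    have h4 := (ENNReal.continuous_rpow_const (y := (1 / 2 : ℝ))).tendsto 0 |>.comp h3
    rw [ENNReal.zero_rpow_of_pos (by norm_num)] at h4
    refine h4.congr fun R => ?_
    simp only [Function.comp]
    rw [← ENNReal.rpow_natCast, ← ENNReal.rpow_mul]
    norm_num

/-! ### Intertwining with the dilation by `θ` -/

/-- A positive factor can be pulled out of a principal power without changing the branch. This
matches the root produced by the complex Gaussian integral with the `√(1 - θ²)` in the kernel, with
no sign ambiguity. -/
theorem c₀_mul_cpow {σ : ℝ} (hσ : 0 < σ) (s : ℂ) :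
    (c₀ σ : ℂ) * (Real.pi / σ * s) ^ (1 / 2 : ℂ) = s ^ (1 / 2 : ℂ) := by
  have hp : 0 < Real.pi / σ := div_pos Real.pi_pos hσ
  have h : ((Real.pi / σ : ℝ) * s : ℂ) ^ (1 / 2 : ℂ) =
      ((Real.pi / σ : ℝ) : ℂ) ^ (1 / 2 : ℂ) * s ^ (1 / 2 : ℂ) := by
    rcases eq_or_ne s 0 with rfl | hs
    · simp
    · have hp' : ((Real.pi / σ : ℝ) : ℂ) ≠ 0 := by exact_mod_cast hp.ne'
      rw [Complex.cpow_def_of_ne_zero (mul_ne_zero hp' hs), Complex.cpow_def_of_ne_zero hp',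
        Complex.cpow_def_of_ne_zero hs, Complex.log_ofReal_mul hp hs, ← Complex.ofReal_log hp.le,
        add_mul, Complex.exp_add]
  have h2 : ((Real.pi / σ : ℝ) : ℂ) ^ (1 / 2 : ℂ) = (√(Real.pi / σ) : ℝ) := by
    rw [Real.sqrt_eq_rpow, Complex.ofReal_cpow hp.le]; norm_num
  push_cast at h h2
  rw [h, h2, ← mul_assoc, ← Complex.ofReal_mul, c₀, ← Real.sqrt_mul (div_pos hσ Real.pi_pos).le]
  have : σ / Real.pi * (Real.pi / σ) = 1 := by
    have := Real.pi_ne_zero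
    field_simp
  rw [this]; simp

/-- Since `1 + θ²w = w`, the coefficient of `y²` in the product is `-σw`, of real part `-σ/2`. The
Gaussian integral therefore converges, and completing the square leaves the Segal-Bargmann kernel at
`θz`. -/
theorem integral_gaussian_shift_mul_fracKernel {σ : ℝ} (hσ : 0 < σ) (a : ℝ) {θ : ℂ}
    (hθ : ‖θ‖ = 1) (h1 : 1 - θ ^ 2 ≠ 0) (z : ℂ) (x : ℝ) :
    ∫ y : ℝ, Complex.exp (-(σ * (y - a * z) ^ 2)) * fracKernel σ θ x y =
      Complex.exp (-(σ * (x - a * (θ * z)) ^ 2)) := by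
  obtain ⟨τ, κ, hκ0, hτ, hκ⟩ := exists_inv_one_sub_sq hθ h1
  have hσ' : (σ : ℂ) ≠ 0 := by exact_mod_cast hσ.ne'
  set w := (1 - θ ^ 2)⁻¹ with hw
  have hre : (-σ * w).re < 0 := by
    rw [hτ]; simp; linarith
  have e : ∀ y : ℝ, Complex.exp (-(σ * (y - a * z) ^ 2)) * fracKernel σ θ x y =
      c₀ σ * ((1 - θ ^ 2) ^ (1 / 2 : ℂ))⁻¹ *
      Complex.exp (-σ * w * y ^ 2 + (2 * σ * a * z + 2 * σ * w * θ * x) * y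
        + (-σ * a ^ 2 * z ^ 2 - σ * w * x ^ 2)) := by
    intro y
    have hw2 : 1 + θ ^ 2 * w = w := by rw [hw]; field_simp; ring
    rw [fracKernel, mul_left_comm, ← Complex.exp_add]
    congr 2
    linear_combination (-σ * y ^ 2) * hw2
  simp_rw [e]
  rw [integral_const_mul, integral_cexp_quadratic hre]
  have e1 : (Real.pi / -(-σ * w) : ℂ) = Real.pi / σ * (1 - θ ^ 2) := by
    rw [hw]; field_simp
  have e2 : (-σ * a ^ 2 * z ^ 2 - σ * w * x ^ 2 -
      (2 * σ * a * z + 2 * σ * w * θ * x) ^ 2 / (4 * (-σ * w)) : ℂ) =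
      -(σ * (x - a * (θ * z)) ^ 2) := by
    rw [hw]; field_simp; ring
  rw [e1, e2, mul_assoc, mul_left_comm, ← mul_assoc, ← mul_assoc, mul_assoc _ (c₀ σ : ℂ),
    c₀_mul_cpow hσ, inv_mul_cancel₀, one_mul]
  rw [Complex.cpow_ne_zero_iff_of_exponent_ne_zero (by norm_num)]
  exact h1

/-- Fubini applies because the growth `e^{σy²/2}` of the kernel is beaten by the factor `e^{-σy²}`
of the Segal-Bargmann kernel: up to a constant and a phase the integrand is a Gaussian-type function
of `y` times an integrable function of `x`. -/
theorem segal_fracIntegral {σ : ℝ} (hσ : 0 < σ) (a : ℝ) {θ : ℂ} (hθ : ‖θ‖ = 1)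
    (h1 : 1 - θ ^ 2 ≠ 0) {ψ : ℝ → ℂ} (hψ : Integrable fun x => chirp σ 0 x * ψ x) (z : ℂ) :
    segal σ a (fracIntegral σ θ ψ) z = segal σ a ψ (θ * z) := by
  obtain ⟨τ, κ, hκ0, hτ, hκ⟩ := exists_inv_one_sub_sq hθ h1
  have hint : Integrable (fun p : ℝ × ℝ =>
      Complex.exp (-(σ * (p.1 - a * z) ^ 2)) * (ψ p.2 * fracKernel σ θ p.2 p.1))
      (volume.prod volume) := by
    have hy : Integrable (fun y : ℝ => Complex.exp (-(σ / 2) * y ^ 2 + 2 * σ * a * z * y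
        + -σ * a ^ 2 * z ^ 2)) :=
      integrable_cexp_quadratic (b := σ / 2) (by simpa using hσ) _ _
    have h2 := (hy.mul_prod hψ).const_mul (c₀ σ * ((1 - θ ^ 2) ^ (1 / 2 : ℂ))⁻¹)
    let u : ℝ × ℝ → ℂ := fun p =>
      Complex.exp ((σ * (-τ * p.2 ^ 2 + 2 * κ * p.2 * p.1 - τ * p.1 ^ 2) : ℝ) * Complex.I)
    have hu : Continuous u := by fun_prop
    refine (h2.bdd_mul (c := 1) hu.aestronglyMeasurable
      (Eventually.of_forall fun p => (Complex.norm_exp_ofReal_mul_I _).le)).congr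
      (Eventually.of_forall fun p => ?_)
    simp only [fracKernel, chirp, u]
    rw [fracKernel_exponent h1 hτ hκ]
    have e : Complex.exp (-(σ * (p.1 - a * z) ^ 2)) *
        Complex.exp (-σ * (1 / 2 + τ * Complex.I) * p.2 ^ 2 +
          (2 * σ * κ * Complex.I) * p.2 * p.1 - σ * (-1 / 2 + τ * Complex.I) * p.1 ^ 2) =
        Complex.exp ((σ * (-τ * p.2 ^ 2 + 2 * κ * p.2 * p.1 - τ * p.1 ^ 2) : ℝ) * Complex.I) *
        Complex.exp (-(σ / 2) * p.1 ^ 2 + 2 * σ * a * z * p.1 + -σ * a ^ 2 * z ^ 2) *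
        Complex.exp (-σ * (1 / 2 + (0 : ℝ) * Complex.I) * p.2 ^ 2) := by
      simp only [← Complex.exp_add]
      congr 1; push_cast; ring
    linear_combination (-(c₀ σ * ((1 - θ ^ 2) ^ (1 / 2 : ℂ))⁻¹) * ψ p.2) * e
  simp only [segal, fracIntegral]
  congr 1
  calc ∫ y : ℝ, Complex.exp (-(σ * (y - a * z) ^ 2)) * ∫ x : ℝ, ψ x * fracKernel σ θ x y
      = ∫ y : ℝ, ∫ x : ℝ, Complex.exp (-(σ * (y - a * z) ^ 2)) * (ψ x * fracKernel σ θ x y) := by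
        simp_rw [integral_const_mul]
    _ = ∫ x : ℝ, ∫ y : ℝ, Complex.exp (-(σ * (y - a * z) ^ 2)) * (ψ x * fracKernel σ θ x y) :=
        integral_integral_swap hint
    _ = _ := by
        refine integral_congr_ae (Eventually.of_forall fun x => ?_)
        simp only
        simp_rw [mul_left_comm _ (ψ x)]
        rw [integral_const_mul, integral_gaussian_shift_mul_fracKernel hσ a hθ h1, mul_comm]

/-- The Segal-Bargmann transform intertwines the limit in mean of the fractional Fourier
integrals with the dilation by `θ`. -/
theorem segal_eq_of_tendsto_fracIntegral {σ : ℝ} (hσ : 0 < σ) (a : ℝ) {θ : ℂ} (hθ : ‖θ‖ = 1)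
    (h1 : 1 - θ ^ 2 ≠ 0) {ψ g : ℝ → ℂ} (hψ : MemLp ψ 2 (realGaussian σ))
    (hg : MemLp g 2 (realGaussian σ))
    (h : Tendsto (fun R : ℝ => eLpNorm (fracIntegral σ θ ((Set.Icc (-R) R).indicator ψ) - g) 2
        (realGaussian σ)) atTop (𝓝 0)) (z : ℂ) :
    segal σ a g z = segal σ a ψ (θ * z) := by
  have hL := tendsto_segal hσ a (exists_tendsto_fracIntegral hσ hθ h1 hψ).1 hg h z
  have hR := tendsto_segal hσ a (fun R : ℝ => hψ.indicator (measurableSet_Icc (a := -R) (b := R)))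
    hψ (tendsto_eLpNorm_indicator_sub hψ) (θ * z)
  refine tendsto_nhds_unique hL (hR.congr fun R => (segal_fracIntegral hσ a hθ h1 ?_ z).symm)
  refine (integrable_indicator_of_memLp
    (memLp_weight_mul hσ hψ (continuous_chirp σ 0) (norm_chirp σ 0)) R).congr
    (Eventually.of_forall fun x => ?_)
  by_cases hx : x ∈ Set.Icc (-R) R <;> simp [hx]

/-! ### Holomorphy of the Segal-Bargmann transform -/

theorem differentiable_integral_cexp_mul {μ : Measure ℝ} {f : ℝ → ℂ}
    (hf : ∀ c : ℝ, Integrable (fun x : ℝ => Complex.exp (c * x) * f x) μ) (b : ℂ) :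
    Differentiable ℂ fun z : ℂ => ∫ x : ℝ, Complex.exp (b * z * x) * f x ∂μ := by
  have hf0 : AEStronglyMeasurable f μ := by simpa using (hf 0).1
  intro z₀
  -- The radius `‖z₀‖ + 1` covers the unit ball around `z₀`; the extra `+ 1` in the exponent absorbs
  -- the factor `|x|` produced by differentiation.
  set B : ℝ := ‖b‖ * (‖z₀‖ + 1) + 1
  have hexp : ∀ (s : ℂ) (x : ℝ), ‖s‖ + 1 ≤ B →
      (|x| + 1) * ‖Complex.exp (s * x)‖ ≤ Real.exp (B * x) + Real.exp (-B * x) := by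
    intro s x hs
    have h1 : |x| + 1 ≤ Real.exp |x| := Real.add_one_le_exp _
    have h2 : ‖Complex.exp (s * x)‖ ≤ Real.exp (‖s‖ * |x|) := by
      rw [Complex.norm_exp]
      refine Real.exp_le_exp.2 ((Complex.re_le_norm _).trans ?_)
      rw [norm_mul, Complex.norm_real, Real.norm_eq_abs]
    have h3 : Real.exp |x| * Real.exp (‖s‖ * |x|) ≤ Real.exp (B * |x|) := by
      rw [← Real.exp_add]
      refine Real.exp_le_exp.2 ?_
      nlinarith [abs_nonneg x]
    have h4 : Real.exp (B * |x|) ≤ Real.exp (B * x) + Real.exp (-B * x) := by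
      rcases abs_cases x with ⟨h, _⟩ | ⟨h, _⟩ <;> rw [h]
      · exact le_add_of_nonneg_right (Real.exp_nonneg _)
      · rw [mul_neg, ← neg_mul]; exact le_add_of_nonneg_left (Real.exp_nonneg _)
    exact (mul_le_mul h1 h2 (norm_nonneg _) (Real.exp_nonneg _)).trans (h3.trans h4)
  have hbound : Integrable (fun x : ℝ =>
      (Real.exp (B * x) + Real.exp (-B * x)) * ‖f x‖) μ := by
    have := (hf B).norm.add (hf (-B)).norm
    refine this.congr (Eventually.of_forall fun x => ?_)
    simp [Complex.norm_exp, add_mul]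
  have hs : ∀ z ∈ Metric.ball z₀ 1, ‖b * z‖ + 1 ≤ B := by
    intro z hz
    have h1 : ‖z‖ ≤ ‖z₀‖ + 1 := by
      rw [Metric.mem_ball, dist_eq_norm] at hz
      have h2 : ‖z₀ - z‖ = ‖z - z₀‖ := norm_sub_rev _ _
      linarith [norm_le_norm_add_norm_sub z₀ z]
    rw [norm_mul]
    have := mul_le_mul_of_nonneg_left h1 (norm_nonneg b)
    simp only [B]; linarith
  have key := hasDerivAt_integral_of_dominated_loc_of_deriv_le (μ := μ) (𝕜 := ℂ)
    (F := fun z x => Complex.exp (b * z * x) * f x)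
    (F' := fun z x => b * x * Complex.exp (b * z * x) * f x) (x₀ := z₀)
    (bound := fun x => ‖b‖ * ((Real.exp (B * x) + Real.exp (-B * x)) * ‖f x‖))
    (Metric.ball_mem_nhds z₀ one_pos)
    (Eventually.of_forall fun z => AEStronglyMeasurable.mul (by fun_prop) hf0)
    (hbound.mono' (AEStronglyMeasurable.mul (by fun_prop) hf0)
      (Eventually.of_forall fun x => ?_))
    (AEStronglyMeasurable.mul (by fun_prop) hf0)
    (Eventually.of_forall fun x z hz => ?_)
    (hbound.const_mul _)
    (Eventually.of_forall fun x z hz => ?_)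
  · exact key.2.differentiableAt
  · rw [norm_mul]
    refine mul_le_mul_of_nonneg_right ?_ (norm_nonneg _)
    refine le_trans ?_ (hexp _ x (hs z₀ (Metric.mem_ball_self one_pos)))
    exact le_mul_of_one_le_left (norm_nonneg _) (by linarith [abs_nonneg x])
  · rw [norm_mul, norm_mul, norm_mul, Complex.norm_real, Real.norm_eq_abs, mul_assoc, mul_assoc,
      ← mul_assoc |x|]
    refine mul_le_mul_of_nonneg_left ?_ (norm_nonneg _)
    refine mul_le_mul_of_nonneg_right ?_ (norm_nonneg _)
    refine le_trans ?_ (hexp _ x (hs z hz))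
    exact mul_le_mul_of_nonneg_right (by linarith) (norm_nonneg _)
  · have h1 : HasDerivAt (fun z : ℂ => b * z * x) (b * x) z := by
      simpa using ((hasDerivAt_id z).const_mul b).mul_const (x : ℂ)
    have := (h1.cexp).mul_const (f x)
    convert! this using 1
    ring

theorem differentiable_segal {σ : ℝ} (hσ : 0 < σ) (a : ℝ) {ψ : ℝ → ℂ}
    (hψ : MemLp ψ 2 (realGaussian σ)) : Differentiable ℂ (segal σ a ψ) := by
  have h := differentiable_integral_cexp_mul (μ := realGaussian σ) (f := ψ) (fun c => by
    have := (memLp_exp_linear hσ (c : ℂ) 0).integrable_mul hψ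
    simpa using! this) (2 * σ * a)
  have e : segal σ a ψ = fun z => Complex.exp (-(σ * a ^ 2 * z ^ 2)) *
      ∫ x : ℝ, Complex.exp (2 * σ * a * z * x) * ψ x ∂realGaussian σ := by
    funext z
    rw [segal_eq_integral_realGaussian hσ, ← integral_const_mul]
    refine integral_congr_ae (Eventually.of_forall fun x => ?_)
    simp only
    rw [← mul_assoc, ← Complex.exp_add]
    congr 2; ring
  rw [e]
  exact (by fun_prop : Differentiable ℂ fun z : ℂ => Complex.exp (-(σ * a ^ 2 * z ^ 2))).mul h

/-! ### The Gaussian measure on the plane -/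

/-- The Gaussian measure `(ν/π) e^{-ν|z|²} dz` on `ℂ`. -/
def fock (ν : ℝ) : Measure ℂ :=
  volume.withDensity fun z => ENNReal.ofReal (ν / Real.pi * Real.exp (-ν * ‖z‖ ^ 2))

theorem measurable_fock_density (ν : ℝ) :
    Measurable fun z : ℂ => ENNReal.ofReal (ν / Real.pi * Real.exp (-ν * ‖z‖ ^ 2)) := by
  fun_prop

theorem lintegral_fock (ν : ℝ) (f : ℂ → ENNReal) :
    ∫⁻ z, f z ∂fock ν =
      ∫⁻ z, ENNReal.ofReal (ν / Real.pi * Real.exp (-ν * ‖z‖ ^ 2)) * f z :=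
  lintegral_withDensity_eq_lintegral_mul_non_measurable _ (measurable_fock_density ν)
    (Eventually.of_forall fun _ => ENNReal.ofReal_lt_top) _

theorem volume_absolutelyContinuous_fock {ν : ℝ} (hν : 0 < ν) : volume ≪ fock ν := by
  refine withDensity_absolutelyContinuous' (measurable_fock_density ν).aemeasurable
    (Eventually.of_forall fun x => ?_)
  have := Real.pi_pos
  simp only [ne_eq, ENNReal.ofReal_eq_zero, not_le]
  positivity

theorem integral_fock {ν : ℝ} (hν : 0 < ν) (f : ℂ → ℂ) :
    ∫ z, f z ∂fock ν = ∫ z, (ν / Real.pi * Real.exp (-ν * ‖z‖ ^ 2) : ℝ) • f z := by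
  rw [fock, integral_withDensity_eq_integral_toReal_smul
    (measurable_fock_density ν) (Eventually.of_forall fun _ => ENNReal.ofReal_lt_top)]
  refine integral_congr_ae (Eventually.of_forall fun x => ?_)
  simp only
  rw [ENNReal.toReal_ofReal]
  have := Real.pi_pos
  positivity

theorem integrable_fock_iff {ν : ℝ} (hν : 0 < ν) (f : ℂ → ℂ) :
    Integrable f (fock ν) ↔
      Integrable fun z => (ν / Real.pi * Real.exp (-ν * ‖z‖ ^ 2) : ℝ) • f z := by
  rw [fock, integrable_withDensity_iff_integrable_smul' (measurable_fock_density ν)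
    (Eventually.of_forall fun _ => ENNReal.ofReal_lt_top)]
  refine integrable_congr (Eventually.of_forall fun x => ?_)
  simp only
  rw [ENNReal.toReal_ofReal]
  have := Real.pi_pos
  positivity

/-- Rotations preserve the Gaussian measure on `ℂ`. -/
theorem measurePreserving_mul_fock (ν : ℝ) {θ : ℂ} (hθ : ‖θ‖ = 1) :
    MeasurePreserving (fun z => θ * z) (fock ν) (fock ν) := by
  have hv : MeasurePreserving (fun z : ℂ => θ * z) volume volume := by
    have := (rotation ⟨θ, by simpa [Submonoid.unitSphere] using hθ⟩).measurePreserving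
    exact this
  have hm : Measurable fun z : ℂ => θ * z := by fun_prop
  refine ⟨hm, ?_⟩
  refine Measure.ext_of_lintegral _ fun f hf => ?_
  rw [lintegral_map hf hm, lintegral_fock, lintegral_fock]
  conv_rhs => rw [← hv.lintegral_comp (by fun_prop)]
  refine lintegral_congr fun z => ?_
  rw [norm_mul, hθ, one_mul]

theorem isFiniteMeasure_fock {ν : ℝ} (hν : 0 < ν) : IsFiniteMeasure (fock ν) := by
  have h : Integrable (fun z : ℂ => (1 : ℂ)) (fock ν) := by
    rw [integrable_fock_iff hν]
    have h2 := GaussianFourier.integrable_cexp_neg_mul_sq_norm_add (V := ℂ) (b := ν)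
      (by simpa using hν) 0 0
    refine (h2.norm.const_mul (ν / Real.pi)).ofReal.congr (Eventually.of_forall fun z => ?_)
    simp [Complex.norm_exp, ← Complex.ofReal_pow]
  rw [integrable_const_iff] at h
  simpa using h

/-- The mean value property for the Gaussian measure on `ℂ`. -/
theorem integral_fock_of_differentiable {ν : ℝ} (hν : 0 < ν) {F : ℂ → ℂ} (hF : Differentiable ℂ F)
    (hi : Integrable F (fock ν)) : ∫ z, F z ∂fock ν = (fock ν).real Set.univ • F 0 := by
  have := isFiniteMeasure_fock hν
  have hrot : ∀ t : ℝ, MeasurePreserving (fun z => Complex.exp (t * Complex.I) * z)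
      (fock ν) (fock ν) := fun t =>
    measurePreserving_mul_fock ν (Complex.norm_exp_ofReal_mul_I t)
  have hcont : Continuous fun p : ℝ × ℂ => F (Complex.exp (p.1 * Complex.I) * p.2) :=
    hF.continuous.comp (by fun_prop)
  have hprod : Integrable (fun p : ℝ × ℂ => F (Complex.exp (p.1 * Complex.I) * p.2))
      ((volume.restrict (Set.Ioc 0 (2 * Real.pi))).prod (fock ν)) := by
    rw [integrable_prod_iff hcont.aestronglyMeasurable]
    constructor
    · exact Eventually.of_forall fun t => (hrot t).integrable_comp_of_integrable hi
    · have : ∀ t : ℝ, ∫ z, ‖F (Complex.exp (t * Complex.I) * z)‖ ∂fock ν =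
          ∫ z, ‖F z‖ ∂fock ν := fun t => by
        conv_rhs => rw [← (hrot t).map_eq]
        rw [integral_map (by fun_prop)]
        exact hF.continuous.norm.aestronglyMeasurable
      simp_rw [this]
      exact integrable_const _
  have hswap := integral_integral_swap
    (f := fun (t : ℝ) (z : ℂ) => F (Complex.exp (t * Complex.I) * z)) hprod
  have hL : ∀ t : ℝ, ∫ z, F (Complex.exp (t * Complex.I) * z) ∂fock ν = ∫ z, F z ∂fock ν :=
    fun t => by
      conv_rhs => rw [← (hrot t).map_eq]
      rw [integral_map (by fun_prop)]
      exact hF.continuous.aestronglyMeasurable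
  -- The average over all rotations of a fixed `z` is a circle average of `w ↦ F (w z)`, hence the
  -- value at the centre; rotation invariance makes the other iterated integral constant in `t`.
  have hR : ∀ z : ℂ, ∫ t in Set.Ioc 0 (2 * Real.pi), F (Complex.exp (t * Complex.I) * z) =
      (2 * Real.pi) • F 0 := by
    intro z
    have hG : Differentiable ℂ fun w => F (w * z) := hF.comp (by fun_prop)
    have h := (hG.diffContOnCl (s := Metric.ball 0 |1|)).circleAverage
    rw [Real.circleAverage_def, zero_mul, intervalIntegral.integral_of_le (by positivity)] at h
    simp only [circleMap, zero_add, Complex.ofReal_one, one_mul] at h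
    rw [← h, smul_smul, mul_inv_cancel₀ (by positivity), one_smul]
  simp_rw [hL, hR] at hswap
  rw [integral_const, integral_const, measureReal_restrict_apply_univ, Real.volume_real_Ioc,
    sub_zero, max_eq_left (by positivity), smul_comm] at hswap
  exact smul_right_injective ℂ (r := 2 * Real.pi) (by positivity) hswap

theorem lintegral_fock_re_im {ν : ℝ} (hν : 0 < ν) {f : ℂ → ENNReal} (hf : Measurable f) :
    ∫⁻ z, f z ∂fock ν = ∫⁻ u : ℝ, ENNReal.ofReal (ν / Real.pi * Real.exp (-ν * u ^ 2)) *
      ∫⁻ v : ℝ, ENNReal.ofReal (Real.exp (-ν * v ^ 2)) * f ⟨u, v⟩ := by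
  have hm : Measurable fun z : ℂ =>
      ENNReal.ofReal (ν / Real.pi * Real.exp (-ν * ‖z‖ ^ 2)) * f z :=
    (measurable_fock_density ν).mul hf
  rw [lintegral_fock, ← Complex.volume_preserving_equiv_real_prod.symm.lintegral_comp hm,
    Measure.volume_eq_prod, lintegral_prod _ (Measurable.aemeasurable
      (by exact hm.comp Complex.measurableEquivRealProd.symm.measurable))]
  refine lintegral_congr fun u => ?_
  rw [← lintegral_const_mul' _ _ ENNReal.ofReal_ne_top]
  refine lintegral_congr fun v => ?_
  have hp := Real.pi_pos
  rw [← mul_assoc, ← ENNReal.ofReal_mul (by positivity), mul_assoc, ← Real.exp_add]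
  simp only [Complex.measurableEquivRealProd_symm_apply]
  have h : ‖(⟨u, v⟩ : ℂ)‖ ^ 2 = u ^ 2 + v ^ 2 := by
    rw [← Complex.normSq_eq_norm_sq, Complex.normSq_mk]; ring
  rw [h, mul_add]

/-! ### The isometry -/

theorem memLp_gaussian_shift_mul {σ : ℝ} (hσ : 0 < σ) (a : ℝ) {ψ : ℝ → ℂ}
    (hψ : MemLp ψ 2 (realGaussian σ)) (u : ℝ) :
    MemLp (fun x : ℝ => Complex.exp (-(σ * (x - a * u) ^ 2)) * ψ x) 2 volume := by
  have h1 := memLp_weight_mul hσ hψ (continuous_chirp σ 0) (norm_chirp σ 0)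
  have hm := hψ.1.mono_ac (volume_absolutelyContinuous_realGaussian hσ)
  refine h1.of_le_mul (c := Real.exp (σ * a ^ 2 * u ^ 2))
    (AEStronglyMeasurable.mul (by fun_prop) hm) (Eventually.of_forall fun x => ?_)
  rw [norm_mul, norm_mul, norm_chirp, ← mul_assoc, norm_gaussian_shift, ← Real.exp_add,
    ← Real.exp_add]
  refine mul_le_mul_of_nonneg_right (Real.exp_le_exp.2 ?_) (norm_nonneg _)
  simp
  -- The gap between the two exponents is `σ (x - 2au)² / 2`.
  nlinarith [mul_nonneg hσ.le (sq_nonneg (x - 2 * a * u))]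

/-- On vertical lines the Segal-Bargmann transform is a Fourier transform. -/
theorem norm_segal_mk {σ : ℝ} (hσ : 0 < σ) (a : ℝ) (ψ : ℝ → ℂ) (u v : ℝ) :
    ‖segal σ a ψ ⟨u, v⟩‖ = c₀ σ * Real.exp (σ * a ^ 2 * v ^ 2) *
      ‖𝓕 (fun x : ℝ => Complex.exp (-(σ * (x - a * u) ^ 2)) * ψ x) (-(σ * a / Real.pi) * v)‖ := by
  have hp : (Real.pi : ℂ) ≠ 0 := by exact_mod_cast Real.pi_ne_zero
  have e : segal σ a ψ ⟨u, v⟩ = c₀ σ * Complex.exp ((σ * a ^ 2 * v ^ 2 : ℝ)) *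
      Complex.exp ((-2 * σ * a ^ 2 * u * v : ℝ) * Complex.I) *
      𝓕 (fun x : ℝ => Complex.exp (-(σ * (x - a * u) ^ 2)) * ψ x) (-(σ * a / Real.pi) * v) := by
    rw [segal, Real.fourier_real_eq_integral_exp_smul, mul_assoc, mul_assoc]
    refine congrArg ((c₀ σ : ℂ) * ·) ?_
    rw [← integral_const_mul, ← integral_const_mul]
    refine integral_congr_ae (Eventually.of_forall fun x => ?_)
    simp only [smul_eq_mul]
    simp only [← mul_assoc, ← Complex.exp_add]
    congr 2
    have hz : (⟨u, v⟩ : ℂ) = u + v * Complex.I := Complex.mk_eq_add_mul_I u v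
    rw [hz]
    push_cast
    field_simp
    linear_combination (-(σ : ℂ) * a ^ 2 * v ^ 2) * Complex.I_sq
  rw [e, norm_mul, norm_mul, norm_mul, Complex.norm_exp_ofReal_mul_I, mul_one, ← Complex.ofReal_exp,
    Complex.norm_real, Complex.norm_real, Real.norm_of_nonneg (c₀_pos hσ).le,
    Real.norm_of_nonneg (Real.exp_nonneg _)]

/-- Completing the square: `2a²u² + 2(x - au)² = 4a²(u - x/(2a))² + x²`, so integrating out `u`
restores exactly the weight `e^{-σx²}`. -/
theorem lintegral_gaussian_mul_gaussian {σ a : ℝ} (hσ : 0 < σ) (ha : 0 < a) (x : ℝ) :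
    ∫⁻ u : ℝ, ENNReal.ofReal (Real.exp (-(2 * σ * a ^ 2) * u ^ 2) *
      Real.exp (-2 * σ * (x - a * u) ^ 2)) =
    ENNReal.ofReal (√(Real.pi / (4 * σ * a ^ 2)) * Real.exp (-σ * x ^ 2)) := by
  have hb : 0 < 4 * σ * a ^ 2 := by positivity
  have e : ∀ u : ℝ, ENNReal.ofReal (Real.exp (-(2 * σ * a ^ 2) * u ^ 2) *
      Real.exp (-2 * σ * (x - a * u) ^ 2)) =
      ENNReal.ofReal (Real.exp (-σ * x ^ 2)) *
        ENNReal.ofReal (Real.exp (-(4 * σ * a ^ 2) * (u - x / (2 * a)) ^ 2)) := by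
    intro u
    rw [← ENNReal.ofReal_mul (Real.exp_nonneg _), ← Real.exp_add, ← Real.exp_add]
    congr 2
    field_simp
    ring
  simp_rw [e]
  rw [lintegral_const_mul' _ _ ENNReal.ofReal_ne_top,
    lintegral_sub_right_eq_self
      (fun u => ENNReal.ofReal (Real.exp (-(4 * σ * a ^ 2) * u ^ 2))),
    ← ofReal_integral_eq_lintegral_ofReal (integrable_exp_neg_mul_sq hb)
      (Eventually.of_forall fun _ => Real.exp_nonneg _), integral_gaussian,
    ← ENNReal.ofReal_mul (Real.exp_nonneg _), mul_comm]

/-- The Segal-Bargmann transform is isometric. -/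
theorem eLpNorm_segal {σ a : ℝ} (hσ : 0 < σ) (ha : 0 < a) {ψ : ℝ → ℂ}
    (hψ : MemLp ψ 2 (realGaussian σ)) :
    eLpNorm (segal σ a ψ) 2 (fock (2 * σ * a ^ 2)) = eLpNorm ψ 2 (realGaussian σ) := by
  have hp := Real.pi_pos
  have hc := c₀_pos hσ
  have hν : 0 < 2 * σ * a ^ 2 := by positivity
  have hm := hψ.1.mono_ac (volume_absolutelyContinuous_realGaussian hσ)
  have hk : -(σ * a / Real.pi) ≠ 0 := neg_ne_zero.2 (by positivity)
  have hcont := (differentiable_segal hσ a hψ).continuous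
  refine (ENNReal.pow_right_strictMono two_ne_zero).injective ?_
  rw [eLpNorm_two_sq, eLpNorm_two_sq,
    lintegral_fock_re_im hν (hcont.measurable.enorm.pow_const 2)]
  obtain ⟨C, hC⟩ : ∃ C : ℝ, C = c₀ σ ^ 2 * |(-(σ * a / Real.pi))⁻¹| := ⟨_, rfl⟩
  have hin : ∀ u : ℝ, ∫⁻ v : ℝ, ENNReal.ofReal (Real.exp (-(2 * σ * a ^ 2) * v ^ 2)) *
      ‖segal σ a ψ ⟨u, v⟩‖ₑ ^ 2 = ENNReal.ofReal C *
        ∫⁻ x : ℝ, ENNReal.ofReal (Real.exp (-2 * σ * (x - a * u) ^ 2)) * ‖ψ x‖ₑ ^ 2 := by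
    intro u
    have hi : Integrable fun x : ℝ => Complex.exp (-(σ * (x - a * u) ^ 2)) * ψ x :=
      integrable_gaussian_shift_mul hσ a hψ u
    have hL := memLp_gaussian_shift_mul hσ a hψ u
    set h : ℝ → ℂ := fun x : ℝ => Complex.exp (-(σ * (x - a * u) ^ 2)) * ψ x with hh
    -- The Gaussian weight in `v` exactly cancels the growth `e^{σa²v²}` of the transform, squared;
    -- this is why the measure has parameter `2σa²`.
    have e1 : ∀ v : ℝ, ENNReal.ofReal (Real.exp (-(2 * σ * a ^ 2) * v ^ 2)) *
        ‖segal σ a ψ ⟨u, v⟩‖ₑ ^ 2 =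
        ENNReal.ofReal (c₀ σ ^ 2) * ‖𝓕 h (-(σ * a / Real.pi) * v)‖ₑ ^ 2 := by
      intro v
      rw [← ofReal_norm, ← ofReal_norm, norm_segal_mk hσ, ← ENNReal.ofReal_pow (by positivity),
        ← ENNReal.ofReal_pow (by positivity), ← ENNReal.ofReal_mul (by positivity),
        ← ENNReal.ofReal_mul (by positivity)]
      congr 1
      have hE : Real.exp (-(2 * σ * a ^ 2) * v ^ 2) * Real.exp (σ * a ^ 2 * v ^ 2) ^ 2 = 1 := by
        rw [← Real.exp_nat_mul, ← Real.exp_add, ← Real.exp_zero]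
        congr 1; push_cast; ring
      rw [← hh]
      linear_combination (c₀ σ ^ 2 * ‖𝓕 h (-(σ * a / Real.pi) * v)‖ ^ 2) * hE
    simp_rw [e1]
    rw [lintegral_const_mul' _ _ ENNReal.ofReal_ne_top,
      lintegral_comp_mul_left hk (fun w => ‖𝓕 h w‖ₑ ^ 2), ← eLpNorm_two_sq,
      eLpNorm_fourier_eq hi hL, eLpNorm_two_sq, ← mul_assoc,
      ← ENNReal.ofReal_mul (by positivity), ← hC]
    congr 1
    refine lintegral_congr fun x => ?_
    rw [hh]
    simp only
    rw [enorm_mul, mul_pow]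
    congr 1
    rw [← ofReal_norm, ← ENNReal.ofReal_pow (norm_nonneg _), norm_gaussian_shift]
    simp only [Complex.ofReal_im, Complex.ofReal_re, ne_eq, OfNat.ofNat_ne_zero, not_false_eq_true,
      zero_pow, mul_zero, Real.exp_zero, one_mul]
    rw [← Real.exp_nat_mul]
    congr 2; push_cast; ring
  simp_rw [hin]
  have hC0 : 0 ≤ C := by rw [hC]; positivity
  obtain ⟨D, hD⟩ : ∃ D : ℝ, D = 2 * σ * a ^ 2 / Real.pi * C := ⟨_, rfl⟩
  have hD0 : 0 ≤ D := by rw [hD]; positivity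
  have e2 : ∀ u : ℝ, ENNReal.ofReal (2 * σ * a ^ 2 / Real.pi *
      Real.exp (-(2 * σ * a ^ 2) * u ^ 2)) * (ENNReal.ofReal C *
        ∫⁻ x : ℝ, ENNReal.ofReal (Real.exp (-2 * σ * (x - a * u) ^ 2)) * ‖ψ x‖ₑ ^ 2) =
      ∫⁻ x : ℝ, ENNReal.ofReal D * (ENNReal.ofReal (Real.exp (-(2 * σ * a ^ 2) * u ^ 2) *
        Real.exp (-2 * σ * (x - a * u) ^ 2)) * ‖ψ x‖ₑ ^ 2) := by
    intro u
    rw [← mul_assoc, ← ENNReal.ofReal_mul (by positivity),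
      ← lintegral_const_mul' _ _ ENNReal.ofReal_ne_top]
    refine lintegral_congr fun x => ?_
    rw [← mul_assoc (ENNReal.ofReal _) (ENNReal.ofReal _),
      ← mul_assoc (ENNReal.ofReal D), ← ENNReal.ofReal_mul (by positivity),
      ← ENNReal.ofReal_mul hD0]
    congr 2
    rw [hD]; ring
  simp_rw [e2]
  rw [lintegral_lintegral_swap, lintegral_realGaussian]
  · refine lintegral_congr fun x => ?_
    rw [lintegral_const_mul' _ _ ENNReal.ofReal_ne_top,
      lintegral_mul_const' (‖ψ x‖ₑ ^ 2) _ (by finiteness),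
      lintegral_gaussian_mul_gaussian hσ ha, ← mul_assoc, ← ENNReal.ofReal_mul hD0]
    congr 2
    rw [← mul_assoc]
    congr 1
    have h4 : √(Real.pi / (4 * σ * a ^ 2)) = √(Real.pi / σ) / (2 * a) := by
      rw [show Real.pi / (4 * σ * a ^ 2) = Real.pi / σ / (2 * a) ^ 2 by field_simp; ring,
        Real.sqrt_div' _ (by positivity), Real.sqrt_sq (by positivity)]
    have h5 : c₀ σ * √(Real.pi / σ) = 1 := by
      rw [c₀, ← Real.sqrt_mul (by positivity)]
      rw [show σ / Real.pi * (Real.pi / σ) = 1 by field_simp, Real.sqrt_one]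
    have h6 : |(-(σ * a / Real.pi))⁻¹| = Real.pi / (σ * a) := by
      rw [abs_inv, abs_neg, abs_of_pos (by positivity), inv_div]
    rw [hD, hC, h4, h6]
    calc _ = c₀ σ * (c₀ σ * √(Real.pi / σ)) := by field_simp
      _ = _ := by rw [h5, mul_one]
  · have hw : Measurable fun p : ℝ × ℝ => ENNReal.ofReal
        (Real.exp (-(2 * σ * a ^ 2) * p.1 ^ 2) * Real.exp (-2 * σ * (p.2 - a * p.1) ^ 2)) := by
      fun_prop
    exact (hw.aemeasurable.mul (hm.enorm.pow_const 2).comp_snd).const_mul _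

theorem memLp_segal {σ a : ℝ} (hσ : 0 < σ) (ha : 0 < a) {ψ : ℝ → ℂ}
    (hψ : MemLp ψ 2 (realGaussian σ)) : MemLp (segal σ a ψ) 2 (fock (2 * σ * a ^ 2)) :=
  ⟨(differentiable_segal hσ a hψ).continuous.aestronglyMeasurable, by
    rw [eLpNorm_segal hσ ha hψ]; exact hψ.2⟩

/-! ### Surjectivity onto the Bargmann space of the plane -/

theorem segal_add {σ : ℝ} (hσ : 0 < σ) (a : ℝ) {ψ φ : ℝ → ℂ}
    (hψ : MemLp ψ 2 (realGaussian σ)) (hφ : MemLp φ 2 (realGaussian σ)) (z : ℂ) :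
    segal σ a (ψ + φ) z = segal σ a ψ z + segal σ a φ z := by
  simp only [segal, Pi.add_apply, mul_add]
  rw [integral_add (integrable_gaussian_shift_mul hσ a hψ z)
    (integrable_gaussian_shift_mul hσ a hφ z), mul_add]

theorem segal_smul (σ a : ℝ) (c : ℂ) (ψ : ℝ → ℂ) (z : ℂ) :
    segal σ a (c • ψ) z = c * segal σ a ψ z := by
  simp only [segal, Pi.smul_apply, smul_eq_mul, mul_left_comm _ c]
  rw [integral_const_mul, mul_left_comm]

/-- The Segal-Bargmann transform as a linear isometry between `L²` spaces. -/
def segalLI {σ a : ℝ} (hσ : 0 < σ) (ha : 0 < a) :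
    Lp ℂ 2 (realGaussian σ) →ₗᵢ[ℂ] Lp ℂ 2 (fock (2 * σ * a ^ 2)) where
  toFun ψ := (memLp_segal hσ ha (Lp.memLp ψ)).toLp _
  map_add' ψ φ := by
    rw [← MemLp.toLp_add, MemLp.toLp_eq_toLp_iff, segal_congr hσ (Lp.coeFn_add ψ φ)]
    exact Eventually.of_forall (segal_add hσ a (Lp.memLp ψ) (Lp.memLp φ))
  map_smul' c ψ := by
    rw [RingHom.id_apply, ← MemLp.toLp_const_smul, MemLp.toLp_eq_toLp_iff,
      segal_congr hσ (Lp.coeFn_smul c ψ)]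
    exact Eventually.of_forall (segal_smul σ a c ψ)
  norm_map' ψ := by
    rw [LinearMap.coe_mk, AddHom.coe_mk, Lp.norm_toLp, eLpNorm_segal hσ ha (Lp.memLp ψ),
      Lp.norm_def]

/-- Exponentials are mapped to multiples of reproducing kernels. -/
theorem segal_exp {σ a : ℝ} (hσ : 0 < σ) (w z : ℂ) :
    segal σ a (fun x => Complex.exp (2 * σ * a * w * x - σ * a ^ 2 * w ^ 2)) z =
      Complex.exp (2 * σ * a ^ 2 * w * z) := by
  have hσ' : (σ : ℂ) ≠ 0 := by exact_mod_cast hσ.ne'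
  have e : ∀ x : ℝ, Complex.exp (-(σ * (x - a * z) ^ 2)) *
      Complex.exp (2 * σ * a * w * x - σ * a ^ 2 * w ^ 2) =
      Complex.exp (-σ * x ^ 2 + (2 * σ * a * z + 2 * σ * a * w) * x +
        (-σ * a ^ 2 * z ^ 2 - σ * a ^ 2 * w ^ 2)) := by
    intro x
    rw [← Complex.exp_add]
    congr 1; ring
  simp_rw [segal, e]
  rw [integral_cexp_quadratic (by simpa using hσ), neg_neg, ← mul_assoc]
  have h := c₀_mul_cpow hσ 1
  rw [mul_one, Complex.one_cpow] at h
  rw [h, one_mul]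
  congr 1
  field_simp
  ring

/-- The reproducing property of the Bargmann space of `ℂ`: an entire function orthogonal to the
kernels vanishes. -/
theorem eq_zero_of_integral_kernel_eq_zero {ν : ℝ} (hν : 0 < ν) {g : ℂ → ℂ}
    (hg : Differentiable ℂ g) (w : ℂ)
    (hi : Integrable (fun z => (starRingEnd ℂ) (Complex.exp (ν * (starRingEnd ℂ) w * z)) * g z)
      (fock ν))
    (h : ∫ z, (starRingEnd ℂ) (Complex.exp (ν * (starRingEnd ℂ) w * z)) * g z ∂fock ν = 0) :
    g w = 0 := by
  -- Translating by `w` cancels the antiholomorphic part: `-ν|ζ+w|² + νw·conj(ζ+w) = -ν|ζ|² -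
  -- ν·conj(w)·ζ`. What remains is entire in `ζ` with value `g w` at `0`, so the mean value property
  -- applies.
  have e : ∀ ζ : ℂ, (ν / Real.pi * Real.exp (-ν * ‖ζ + w‖ ^ 2) : ℝ) •
      ((starRingEnd ℂ) (Complex.exp (ν * (starRingEnd ℂ) w * (ζ + w))) * g (ζ + w)) =
      (ν / Real.pi * Real.exp (-ν * ‖ζ‖ ^ 2) : ℝ) •
        (Complex.exp (-(ν * (starRingEnd ℂ) w * ζ)) * g (ζ + w)) := by
    intro ζ
    rw [Complex.real_smul, Complex.real_smul, ← Complex.exp_conj]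
    push_cast
    have h1 : Complex.exp (-ν * ‖ζ + w‖ ^ 2) *
        Complex.exp ((starRingEnd ℂ) (ν * (starRingEnd ℂ) w * (ζ + w))) =
        Complex.exp (-ν * ‖ζ‖ ^ 2) * Complex.exp (-(ν * (starRingEnd ℂ) w * ζ)) := by
      rw [← Complex.exp_add, ← Complex.exp_add, ← Complex.conj_mul', ← Complex.conj_mul']
      congr 1
      simp only [map_mul, map_add, Complex.conj_conj, Complex.conj_ofReal]
      ring
    linear_combination (ν / Real.pi * g (ζ + w)) * h1
  have hF : Differentiable ℂ fun ζ : ℂ => Complex.exp (-(ν * (starRingEnd ℂ) w * ζ)) * g (ζ + w) :=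
    (by fun_prop : Differentiable ℂ fun ζ : ℂ => Complex.exp (-(ν * (starRingEnd ℂ) w * ζ))).mul
      (hg.comp (by fun_prop))
  rw [integrable_fock_iff hν] at hi
  rw [integral_fock hν, ← integral_add_right_eq_self _ w] at h
  have hi2 := hi.comp_add_right w
  simp_rw [e] at hi2 h
  rw [← integral_fock hν] at h
  rw [← integrable_fock_iff hν] at hi2
  rw [integral_fock_of_differentiable hν hF hi2] at h
  have hne : (fock ν).real Set.univ ≠ 0 := by
    have := isFiniteMeasure_fock hν
    rw [measureReal_def, ENNReal.toReal_ne_zero]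
    refine ⟨fun h0 => ?_, measure_ne_top _ _⟩
    have := volume_absolutelyContinuous_fock hν h0
    simp at this
  simpa [hne] using h

/-- The Segal-Bargmann transform is onto the Bargmann space of `ℂ`. -/
theorem exists_segal_eq {σ a : ℝ} (hσ : 0 < σ) (ha : 0 < a) {f : ℂ → ℂ}
    (hf : Differentiable ℂ f) (hf2 : MemLp f 2 (fock (2 * σ * a ^ 2))) :
    ∃ ψ : ℝ → ℂ, MemLp ψ 2 (realGaussian σ) ∧ segal σ a ψ = f := by
  have hν : 0 < 2 * σ * a ^ 2 := by positivity
  let V := segalLI hσ ha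
  -- For an isometry the adjoint gives the preimage of the orthogonal projection onto the range, so
  -- `f - Vψ` is orthogonal to the range and only its vanishing is left.
  let ψ := ContinuousLinearMap.adjoint V.toContinuousLinearMap (hf2.toLp f)
  refine ⟨ψ, Lp.memLp ψ, ?_⟩
  have hψ := memLp_segal hσ ha (Lp.memLp ψ)
  have horth : ∀ φ, inner ℂ (V φ) (hf2.toLp f - V ψ) = 0 := by
    intro φ
    rw [inner_sub_right, V.inner_map_map, ContinuousLinearMap.adjoint_inner_right]
    exact sub_self _
  have hg : Differentiable ℂ (f - segal σ a ψ) := hf.sub (differentiable_segal hσ a (Lp.memLp ψ))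
  have hg2 := hf2.sub hψ
  funext w
  refine (sub_eq_zero.1 (eq_zero_of_integral_kernel_eq_zero hν hg w ?_ ?_)).symm
  all_goals
    -- The parameter `conj w` makes the image of this exponential the reproducing kernel at `w`.
    have hk : MemLp (fun x : ℝ => Complex.exp (2 * σ * a * (starRingEnd ℂ) w * x -
        σ * a ^ 2 * (starRingEnd ℂ) w ^ 2)) 2 (realGaussian σ) := memLp_exp_linear hσ _ _
    have hVk : V (hk.toLp _) =ᵐ[fock (2 * σ * a ^ 2)]
        fun z => Complex.exp ((2 * σ * a ^ 2 : ℝ) * (starRingEnd ℂ) w * z) := by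
      refine (MemLp.coeFn_toLp (memLp_segal hσ ha (Lp.memLp _))).trans ?_
      rw [segal_congr hσ hk.coeFn_toLp]
      refine Eventually.of_forall fun z => ?_
      simp only
      rw [segal_exp hσ]
      push_cast; rfl
  · have hc : MemLp (fun z => (starRingEnd ℂ) (Complex.exp ((2 * σ * a ^ 2 : ℝ) *
        (starRingEnd ℂ) w * z))) 2 (fock (2 * σ * a ^ 2)) :=
      ((memLp_congr_ae hVk).1 (Lp.memLp _)).star
    exact hc.integrable_mul hg2
  · have h := horth (hk.toLp _)
    rw [L2.inner_def] at h
    rw [← h]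
    refine integral_congr_ae ?_
    filter_upwards [hVk, Lp.coeFn_sub (hf2.toLp f) (V ψ), hf2.coeFn_toLp,
      MemLp.coeFn_toLp hψ] with z h1 h2 h3 h4
    rw [h1, h2, Pi.sub_apply, Pi.sub_apply, h3, RCLike.inner_apply, mul_comm]
    congr 2
    exact h4.symm

end Bargmann

end

noncomputable section

namespace BC

/-! ### Idempotent components of bicomplex numbers -/

/-- The two idempotent components, `plus` for `true` and `minus` for `false`, as algebra
homomorphisms. -/
def component (s : Bool) : BC →ₐ[ℂ] ℂ :=
  AlgHom.ofLinearMap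
    { toFun := fun Z => if s then Z.plus else Z.minus
      map_add' := fun Z W => by cases s <;> simp [plus, minus] <;> ring
      map_smul' := fun c Z => by cases s <;> simp [plus, minus] <;> ring }
    (by cases s <;> simp [plus, minus, QuadraticAlgebra.re_one, QuadraticAlgebra.im_one])
    (fun Z W => by
      cases s <;> simp [plus, minus]
      · linear_combination (-(Z.im * W.im)) * Complex.I_sq
      · linear_combination (-(Z.im * W.im)) * Complex.I_sq)

theorem component_true (Z : BC) : component true Z = Z.plus := rfl

theorem component_false (Z : BC) : component false Z = Z.minus := rfl

/-- The bicomplex number with given idempotent components. -/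
def ofComponents (α : Bool → ℂ) : BC := α true • ePlus + α false • eMinus

theorem component_ofComponents (s : Bool) (α : Bool → ℂ) : component s (ofComponents α) = α s := by
  cases s
  · rw [component_false]
    simp [ofComponents, minus, ePlus, eMinus, j, QuadraticAlgebra.re_one, QuadraticAlgebra.im_one]
    linear_combination ((α true - α false) / 2) * Complex.I_sq
  · rw [component_true]
    simp [ofComponents, plus, ePlus, eMinus, j, QuadraticAlgebra.re_one, QuadraticAlgebra.im_one]
    linear_combination ((α false - α true) / 2) * Complex.I_sq

theorem ofComponents_component (Z : BC) : ofComponents (fun s => component s Z) = Z :=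
  (idempotent_decomposition Z).symm

theorem ext_component {Z W : BC} (h : ∀ s, component s Z = component s W) : Z = W := by
  rw [← ofComponents_component Z, ← ofComponents_component W]
  simp only [h]

theorem component_exp (s : Bool) (Z : BC) : component s (exp Z) = Complex.exp (component s Z) :=
  (component_ofComponents s fun s => Complex.exp (component s Z))

theorem component_sqrt (s : Bool) (Z : BC) :
    component s (sqrt Z) = component s Z ^ (1 / 2 : ℂ) :=
  (component_ofComponents s fun s => component s Z ^ (1 / 2 : ℂ))

theorem component_ofReal (s : Bool) (x : ℝ) : component s (ofReal x) = x := by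
  rw [ofReal, IsScalarTower.algebraMap_apply ℝ ℂ BC, AlgHom.commutes]
  rfl

theorem mem_nullCone_iff (Z : BC) : Z ∈ nullCone ↔ ∃ s, component s Z = 0 := by
  have h : Z.re ^ 2 + Z.im ^ 2 = component true Z * component false Z := by
    rw [component_true, component_false, plus, minus]
    linear_combination (Z.im ^ 2) * Complex.I_sq
  rw [nullCone, Set.mem_ofPred_eq, h, mul_eq_zero, Bool.exists_bool, or_comm]

theorem notMem_nullCone_iff (Z : BC) : Z ∉ nullCone ↔ ∀ s, component s Z ≠ 0 := by
  rw [mem_nullCone_iff, not_exists]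

theorem component_inverse {Z : BC} (hZ : Z ∉ nullCone) (s : Bool) :
    component s (Ring.inverse Z) = (component s Z)⁻¹ := by
  rw [notMem_nullCone_iff] at hZ
  have h1 : Z * ofComponents (fun s => (component s Z)⁻¹) = 1 := by
    refine ext_component fun r => ?_
    rw [map_mul, component_ofComponents, map_one, mul_inv_cancel₀ (hZ r)]
  have hu : IsUnit Z := IsUnit.of_mul_eq_one _ h1
  have h2 := congrArg (component s) (Ring.mul_inverse_cancel Z hu)
  rw [map_mul, map_one] at h2
  exact eq_inv_of_mul_eq_one_right h2

/-- The cross terms cancel by the parallelogram law. The factor `1 / 2` is what turns `ν` into `ν /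
2` in each component. -/
theorem norm_sq_eq_component (Z : BC) :
    ‖Z‖ ^ 2 = (‖component true Z‖ ^ 2 + ‖component false Z‖ ^ 2) / 2 := by
  rw [norm_eq, Real.sq_sqrt (by positivity), component_true, component_false, plus, minus,
    ← Complex.normSq_eq_norm_sq, ← Complex.normSq_eq_norm_sq, ← Complex.normSq_eq_norm_sq,
    ← Complex.normSq_eq_norm_sq, Complex.normSq_apply, Complex.normSq_apply, Complex.normSq_apply,
    Complex.normSq_apply]
  simp
  ring

theorem norm_component_le (s : Bool) (Z : BC) : ‖component s Z‖ ≤ 2 * ‖Z‖ := by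
  have h := norm_sq_eq_component Z
  refine abs_le_of_sq_le_sq' ?_ (by positivity) |>.2
  cases s <;> nlinarith [sq_nonneg ‖component true Z‖, sq_nonneg ‖component false Z‖]

theorem norm_le_component (Z : BC) : ‖Z‖ ≤ ‖component true Z‖ + ‖component false Z‖ := by
  have h := norm_sq_eq_component Z
  refine abs_le_of_sq_le_sq' ?_ (by positivity) |>.2
  nlinarith [norm_nonneg (component true Z), norm_nonneg (component false Z),
    mul_nonneg (norm_nonneg (component true Z)) (norm_nonneg (component false Z))]

/-- The components as continuous real linear maps. -/
def componentCLM (s : Bool) : BC →L[ℝ] ℂ :=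
  LinearMap.toContinuousLinearMap ((component s).toLinearMap.restrictScalars ℝ)

theorem componentCLM_apply (s : Bool) (Z : BC) : componentCLM s Z = component s Z := rfl

theorem continuous_component (s : Bool) : Continuous (component s) := (componentCLM s).continuous

/-- `ofComponents` as a continuous real linear map. -/
def ofComponentsCLM : (Bool → ℂ) →L[ℝ] BC :=
  LinearMap.toContinuousLinearMap
    { toFun := ofComponents
      map_add' := fun α β => ext_component fun s => by simp [component_ofComponents]
      map_smul' := fun c α => ext_component fun s => by
        simp only [component_ofComponents, Pi.smul_apply, RingHom.id_apply]
        exact ((componentCLM s).map_smul c (ofComponents α)).symm ▸ by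
          rw [componentCLM_apply, component_ofComponents] }

theorem continuous_ofComponents : Continuous ofComponents := ofComponentsCLM.continuous

theorem tendsto_iff_component {ι : Type*} {l : Filter ι} {F : ι → BC} {Z : BC} :
    Tendsto F l (𝓝 Z) ↔ ∀ s, Tendsto (fun i => component s (F i)) l (𝓝 (component s Z)) := by
  refine ⟨fun h s => ((continuous_component s).tendsto Z).comp h, fun h => ?_⟩
  have h2 := (continuous_ofComponents.tendsto _).comp (tendsto_pi_nhds.2 h)
  rw [ofComponents_component] at h2
  exact h2.congr fun i => ofComponents_component _

/-! ### Integrability, integrals and `L²` convergence by components -/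

section Measure

variable {α : Type*} [MeasurableSpace α] {μ : Measure α}

theorem memLp_iff_component {f : α → BC} :
    MemLp f 2 μ ↔ ∀ s, MemLp (fun x => component s (f x)) 2 μ := by
  refine ⟨fun h s => (componentCLM s).comp_memLp' h, fun h => ?_⟩
  have h2 := ofComponentsCLM.comp_memLp' (memLp_pi_iff.2 h)
  refine (memLp_congr_ae (Eventually.of_forall fun x => ?_)).1 h2
  exact ofComponents_component _

theorem integrable_iff_component {f : α → BC} :
    Integrable f μ ↔ ∀ s, Integrable (fun x => component s (f x)) μ := by
  refine ⟨fun h s => (componentCLM s).integrable_comp h, fun h => ?_⟩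
  have h2 := ofComponentsCLM.integrable_comp (Integrable.of_eval h)
  refine h2.congr (Eventually.of_forall fun x => ?_)
  exact ofComponents_component _

theorem component_integral {f : α → BC} (hf : Integrable f μ) (s : Bool) :
    component s (∫ x, f x ∂μ) = ∫ x, component s (f x) ∂μ :=
  ((componentCLM s).integral_comp_comm hf).symm

theorem eLpNorm_component_le (f : α → BC) (s : Bool) :
    eLpNorm (fun x => component s (f x)) 2 μ ≤ ENNReal.ofReal 2 * eLpNorm f 2 μ :=
  eLpNorm_le_mul_eLpNorm_of_ae_le_mul (Eventually.of_forall fun x => norm_component_le s (f x)) 2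

theorem eLpNorm_le_component {f : α → BC} (hf : AEStronglyMeasurable f μ) :
    eLpNorm f 2 μ ≤ eLpNorm (fun x => component true (f x)) 2 μ +
      eLpNorm (fun x => component false (f x)) 2 μ := by
  have hm : ∀ s, AEStronglyMeasurable (fun x => component s (f x)) μ := fun s =>
    (continuous_component s).comp_aestronglyMeasurable hf
  rw [← eLpNorm_norm (fun x => component true (f x)), ← eLpNorm_norm (fun x => component false _)]
  refine le_trans (eLpNorm_mono_real (g := fun x => ‖component true (f x)‖ + ‖component false (f x)‖)
    fun x => norm_le_component (f x)) ?_
  exact eLpNorm_add_le (hm true).norm (hm false).norm (by norm_num)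

theorem tendsto_eLpNorm_iff_component {ι : Type*} {l : Filter ι} {F : ι → α → BC} {g : α → BC}
    (hF : ∀ i, AEStronglyMeasurable (F i) μ) (hg : AEStronglyMeasurable g μ) :
    Tendsto (fun i => eLpNorm (F i - g) 2 μ) l (𝓝 0) ↔
      ∀ s, Tendsto (fun i => eLpNorm ((fun x => component s (F i x)) -
        fun x => component s (g x)) 2 μ) l (𝓝 0) := by
  have e : ∀ s i, ((fun x => component s (F i x)) - fun x => component s (g x)) =
      fun x => component s ((F i - g) x) := by
    intro s i; funext x; simp
  simp_rw [e]
  constructor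
  · intro h s
    have h2 : Tendsto (fun i => ENNReal.ofReal 2 * eLpNorm (F i - g) 2 μ) l (𝓝 0) := by
      simpa using ENNReal.Tendsto.const_mul h (Or.inr (ENNReal.ofReal_ne_top (r := 2)))
    exact tendsto_of_tendsto_of_tendsto_of_le_of_le tendsto_const_nhds h2 (fun _ => zero_le)
      fun i => eLpNorm_component_le _ s
  · intro h
    have h2 := (h true).add (h false)
    rw [add_zero] at h2
    exact tendsto_of_tendsto_of_tendsto_of_le_of_le tendsto_const_nhds h2 (fun _ => zero_le)
      fun i => eLpNorm_le_component ((hF i).sub hg)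

end Measure

/-! ### Bicomplex holomorphic functions are pairs of entire functions -/

theorem component_algebraMap (s : Bool) (z : ℂ) : component s (algebraMap ℂ BC z) = z :=
  (component s).commutes z

theorem continuous_algebraMap : Continuous (algebraMap ℂ BC) := by
  have h : (algebraMap ℂ BC : ℂ → BC) = fun z => ofComponents fun _ => z := by
    funext z
    exact ext_component fun s => by rw [component_algebraMap, component_ofComponents]
  rw [h]
  exact continuous_ofComponents.comp (by fun_prop)

theorem algebraMap_notMem_nullCone {z : ℂ} (hz : z ≠ 0) : algebraMap ℂ BC z ∉ nullCone := by
  rw [notMem_nullCone_iff]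
  intro s
  rwa [component_algebraMap]

theorem tendsto_algebraMap_nhdsNE :
    Tendsto (algebraMap ℂ BC) (𝓝[≠] 0) (𝓝[nullConeᶜ] 0) := by
  refine tendsto_nhdsWithin_iff.2 ⟨?_, ?_⟩
  · have := continuous_algebraMap.tendsto 0
    rw [map_zero] at this
    exact this.mono_left nhdsWithin_le_nhds
  · filter_upwards [self_mem_nhdsWithin] with z hz
    exact algebraMap_notMem_nullCone hz

theorem Holomorphic.tendsto_component {f : BC → BC} (hf : Holomorphic f) (s : Bool) (Z₀ : BC) :
    ∃ d : ℂ, Tendsto (fun H : BC => (component s (f (Z₀ + H)) - component s (f Z₀)) *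
      (component s H)⁻¹) (𝓝[nullConeᶜ] 0) (𝓝 d) := by
  obtain ⟨d, hd⟩ := hf Z₀
  refine ⟨component s d, (tendsto_iff_component.1 hd s).congr' ?_⟩
  filter_upwards [self_mem_nhdsWithin] with H hH
  rw [map_mul, map_sub, component_inverse hH]

/-- Near a point, a component of a holomorphic function only depends on that component. -/
theorem Holomorphic.eventually_component_eq {f : BC → BC} (hf : Holomorphic f) (s : Bool)
    (Z₀ : BC) : ∀ᶠ W in 𝓝 (0 : BC), component s W = 0 →
      component s (f (Z₀ + W)) = component s (f Z₀) := by
  obtain ⟨d, hd⟩ := hf.tendsto_component s Z₀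
  -- A convergent quotient is bounded, so for invertible increments the change of the component is
  -- controlled by that component of `H` alone. Vanishing of the latter puts `H` on the null cone,
  -- where the bound must be recovered by a limit.
  have hb : ∀ᶠ H in 𝓝[nullConeᶜ] (0 : BC), ‖component s (f (Z₀ + H)) - component s (f Z₀)‖ ≤
      (‖d‖ + 1) * ‖component s H‖ := by
    have h1 : ∀ᶠ H in 𝓝[nullConeᶜ] (0 : BC), ‖(component s (f (Z₀ + H)) - component s (f Z₀)) *
        (component s H)⁻¹‖ < ‖d‖ + 1 := hd.norm.eventually_lt_const (by linarith)
    filter_upwards [h1, self_mem_nhdsWithin] with H hH hH2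
    have h0 := (notMem_nullCone_iff H).1 hH2 s
    rw [norm_mul, norm_inv, ← div_eq_mul_inv, div_lt_iff₀ (norm_pos_iff.2 h0)] at hH
    exact hH.le
  rw [eventually_nhdsWithin_iff] at hb
  filter_upwards [eventually_eventually_nhds.2 hb] with W hW hWs
  by_cases hW' : component (!s) W = 0
  · have : W = 0 := ext_component fun r => by
      rw [map_zero]
      rcases Bool.eq_or_eq_not r s with rfl | rfl <;> assumption
    rw [this, add_zero]
  -- `W` is approached along `W + z` with `z` a small nonzero complex number, which is invertible
  -- because the other component of `W` is nonzero.
  have hz : Tendsto (fun z : ℂ => W + algebraMap ℂ BC z) (𝓝[≠] 0) (𝓝 W) := by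
    have h1 : Continuous fun z : ℂ => W + algebraMap ℂ BC z :=
      continuous_const.add continuous_algebraMap
    have := h1.tendsto 0
    rw [map_zero, add_zero] at this
    exact this.mono_left nhdsWithin_le_nhds
  have hnull : ∀ᶠ z : ℂ in 𝓝[≠] 0, W + algebraMap ℂ BC z ∈ nullConeᶜ := by
    have h1 : ∀ᶠ z : ℂ in 𝓝[≠] 0, z ≠ -component (!s) W :=
      eventually_nhdsWithin_of_eventually_nhds
        (isOpen_ne.mem_nhds (by simpa [eq_comm] using hW'))
    filter_upwards [h1, self_mem_nhdsWithin] with z hz1 hz2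
    rw [Set.mem_compl_iff, notMem_nullCone_iff]
    intro r
    rw [map_add, component_algebraMap]
    rcases Bool.eq_or_eq_not r s with rfl | rfl
    · rw [hWs, zero_add]; exact hz2
    · intro h
      exact hz1 (eq_neg_of_add_eq_zero_right h)
  have hlim1 : Tendsto (fun z : ℂ => component s (f (Z₀ + (W + algebraMap ℂ BC z))))
      (𝓝[≠] 0) (𝓝 (component s (f Z₀))) := by
    rw [tendsto_iff_norm_sub_tendsto_zero]
    have h2 : Tendsto (fun z : ℂ => (‖d‖ + 1) * ‖z‖) (𝓝[≠] 0) (𝓝 0) := by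
      have h3 : Continuous fun z : ℂ => (‖d‖ + 1) * ‖z‖ := by fun_prop
      have := h3.tendsto 0
      rw [norm_zero, mul_zero] at this
      exact this.mono_left nhdsWithin_le_nhds
    refine squeeze_zero' (Eventually.of_forall fun _ => norm_nonneg _) ?_ h2
    filter_upwards [hz.eventually hW, hnull] with z h4 h5
    have h6 := h4 h5
    rwa [map_add, hWs, zero_add, component_algebraMap] at h6
  -- Differentiability at `Z₀ + W` itself gives continuity along these invertible increments.
  have hlim2 : Tendsto (fun z : ℂ => component s (f (Z₀ + (W + algebraMap ℂ BC z))))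
      (𝓝[≠] 0) (𝓝 (component s (f (Z₀ + W)))) := by
    obtain ⟨d', hd'⟩ := hf.tendsto_component s (Z₀ + W)
    have h1 := hd'.comp tendsto_algebraMap_nhdsNE
    have h2 : Tendsto (fun z : ℂ => z) (𝓝[≠] 0) (𝓝 0) := nhdsWithin_le_nhds
    have h3 := (h1.mul h2).add_const (component s (f (Z₀ + W)))
    rw [mul_zero, zero_add] at h3
    refine h3.congr' ?_
    filter_upwards [self_mem_nhdsWithin] with z hz
    simp only [Function.comp, component_algebraMap]
    rw [inv_mul_cancel_right₀ hz, sub_add_cancel, add_assoc]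
  exact tendsto_nhds_unique hlim2 hlim1

/-- The components of a bicomplex holomorphic function are entire functions of one component. -/
theorem Holomorphic.exists_entire {f : BC → BC} (hf : Holomorphic f) (s : Bool) :
    ∃ F : ℂ → ℂ, Differentiable ℂ F ∧ ∀ Z, component s (f Z) = F (component s Z) := by
  refine ⟨fun z => component s (f (algebraMap ℂ BC z)), fun z => ?_, fun Z => ?_⟩
  · obtain ⟨d, hd⟩ := hf.tendsto_component s (algebraMap ℂ BC z)
    suffices h : HasDerivAt (fun z => component s (f (algebraMap ℂ BC z))) d z from
      h.differentiableAt
    rw [hasDerivAt_iff_tendsto_slope_zero]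
    refine (hd.comp tendsto_algebraMap_nhdsNE).congr fun t => ?_
    simp only [Function.comp, component_algebraMap, map_add, smul_eq_mul]
    rw [mul_comm]
  · let N : BC := ofComponents fun r => if r = s then 0 else 1
    have hN : component s N = 0 := by simp [N, component_ofComponents]
    let γ : ℂ → ℂ := fun k => component s (f (algebraMap ℂ BC (component s Z) + k • N))
    have hcont : Continuous fun k : ℂ => k • N := by
      have : (fun k : ℂ => k • N) = fun k => ofComponents fun r => k * component r N := by
        funext k
        exact ext_component fun r => by
          rw [map_smul, smul_eq_mul, component_ofComponents _ fun r => k * component r N]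
      rw [this]
      exact continuous_ofComponents.comp (by fun_prop)
    have hγ : IsLocallyConstant γ := by
      rw [IsLocallyConstant.iff_eventually_eq]
      intro k
      have h1 := hf.eventually_component_eq s (algebraMap ℂ BC (component s Z) + k • N)
      have h2 : Tendsto (fun k' : ℂ => (k' - k) • N) (𝓝 k) (𝓝 0) := by
        have h3 : Continuous fun k' : ℂ => (k' - k) • N := hcont.comp (by fun_prop)
        have := h3.tendsto k
        rwa [sub_self, zero_smul] at this
      filter_upwards [h2.eventually h1] with k' hk'
      have := hk' (by rw [map_smul, hN, smul_zero])
      rwa [add_assoc, ← add_smul, add_sub_cancel] at this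
    have h := hγ.apply_eq_of_preconnectedSpace (component (!s) Z - component s Z) 0
    simp only [γ, zero_smul, add_zero] at h
    refine Eq.trans (congrArg (fun W => component s (f W)) ?_) h
    refine ext_component fun r => ?_
    rw [map_add, component_algebraMap, map_smul, component_ofComponents]
    rcases Bool.eq_or_eq_not r s with rfl | rfl <;> simp

/-- As `H → 0` off the null cone, each component of `H` tends to `0` through nonzero values, so the
quotient converges componentwise to the complex derivatives. -/
theorem holomorphic_of_entire {f : BC → BC} {F : Bool → ℂ → ℂ} (hF : ∀ s, Differentiable ℂ (F s))
    (h : ∀ s Z, component s (f Z) = F s (component s Z)) : Holomorphic f := by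
  intro Z₀
  refine ⟨ofComponents fun s => deriv (F s) (component s Z₀), ?_⟩
  rw [tendsto_iff_component]
  intro s
  rw [component_ofComponents]
  have hd := hasDerivAt_iff_tendsto_slope_zero.1 ((hF s) (component s Z₀)).hasDerivAt
  have hc : Tendsto (component s) (𝓝[nullConeᶜ] 0) (𝓝[≠] 0) := by
    refine tendsto_nhdsWithin_iff.2 ⟨?_, ?_⟩
    · have := (continuous_component s).tendsto 0
      rw [map_zero] at this
      exact this.mono_left nhdsWithin_le_nhds
    · filter_upwards [self_mem_nhdsWithin] with H hH
      exact (notMem_nullCone_iff H).1 hH s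
  refine (hd.comp hc).congr' ?_
  filter_upwards [self_mem_nhdsWithin] with H hH
  simp only [Function.comp, smul_eq_mul]
  rw [map_mul, map_sub, component_inverse hH, h, h, map_add, mul_comm]

/-! ### The Bargmann space in idempotent components -/

/-- The change from the coordinates `(z₁, z₂)` to the idempotent components. -/
def coordEquiv : (ℂ × ℂ) ≃ₗ[ℝ] ℂ × ℂ where
  toFun p := (p.1 - Complex.I * p.2, p.1 + Complex.I * p.2)
  invFun q := ((q.1 + q.2) / 2, Complex.I * (q.1 - q.2) / 2)
  map_add' p q := by ext1 <;> simp <;> ring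
  map_smul' c p := by ext1 <;> simp <;> ring
  left_inv p := by
    ext1 <;> simp
    linear_combination (-p.2) * Complex.I_sq
  right_inv q := by
    ext1 <;> simp
    · linear_combination (-(q.1 - q.2) / 2) * Complex.I_sq
    · linear_combination ((q.1 - q.2) / 2) * Complex.I_sq

theorem continuous_mk : Continuous fun p : ℂ × ℂ => (⟨p.1, p.2⟩ : BC) := by
  have h : (fun p : ℂ × ℂ => (⟨p.1, p.2⟩ : BC)) = fun p =>
      ofComponents fun s => component s ⟨p.1, p.2⟩ := by
    funext p; rw [ofComponents_component]
  rw [h]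
  refine continuous_ofComponents.comp (continuous_pi fun s => ?_)
  cases s
  · simp only [component_false, minus]; fun_prop
  · simp only [component_true, plus]; fun_prop

/-- The Gaussian measure on `BC` is a multiple of a product in the idempotent components. -/
theorem exists_map_gaussian (ν : ℝ) (hν : 0 < ν) : ∃ K : ENNReal, K ≠ 0 ∧ K ≠ ⊤ ∧
    (gaussian ν).map (fun Z => (component true Z, component false Z)) =
      K • (Bargmann.fock (ν / 2)).prod (Bargmann.fock (ν / 2)) := by
  have hp := Real.pi_pos
  have hdet : LinearMap.det (coordEquiv : (ℂ × ℂ) →ₗ[ℝ] ℂ × ℂ) ≠ 0 :=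
    (LinearEquiv.isUnit_det' coordEquiv).ne_zero
  have : (volume : Measure (ℂ × ℂ)).IsAddHaarMeasure := by
    rw [Measure.volume_eq_prod]; infer_instance
  have hvol := Measure.map_linearMap_addHaar_eq_smul_addHaar (volume : Measure (ℂ × ℂ)) hdet
  set c : ENNReal := ENNReal.ofReal |(LinearMap.det (coordEquiv : (ℂ × ℂ) →ₗ[ℝ] ℂ × ℂ))⁻¹|
  have hc0 : c ≠ 0 := by simpa [c] using hdet
  have hc : Measurable fun Z : BC => (component true Z, component false Z) :=
    ((continuous_component true).prodMk (continuous_component false)).measurable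
  have hL : Measurable (coordEquiv : ℂ × ℂ → ℂ × ℂ) :=
    (LinearMap.continuous_of_finiteDimensional
      (coordEquiv : (ℂ × ℂ) →ₗ[ℝ] ℂ × ℂ)).measurable
  have hd : Measurable fun Z : BC =>
      ENNReal.ofReal ((ν / Real.pi) ^ 2 * Real.exp (-ν * ‖Z‖ ^ 2)) := by fun_prop
  let D : ℂ × ℂ → ENNReal := fun q =>
    ENNReal.ofReal (ν / 2 / Real.pi * Real.exp (-(ν / 2) * ‖q.1‖ ^ 2)) *
      ENNReal.ofReal (ν / 2 / Real.pi * Real.exp (-(ν / 2) * ‖q.2‖ ^ 2))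
  have hD : Measurable D := by fun_prop
  -- The `4` is the ratio of `(ν/π)²` to `(ν/(2π))²`; `c` is the Jacobian factor of the change of
  -- coordinates.
  refine ⟨4 * c, mul_ne_zero four_ne_zero hc0, ENNReal.mul_ne_top (by norm_num)
    ENNReal.ofReal_ne_top, Measure.ext_of_lintegral _ fun φ hφ => ?_⟩
  have hfock : (Bargmann.fock (ν / 2)).prod (Bargmann.fock (ν / 2)) =
      (volume : Measure (ℂ × ℂ)).withDensity D := by
    rw [Bargmann.fock, prod_withDensity (Bargmann.measurable_fock_density _)
      (Bargmann.measurable_fock_density _), Measure.volume_eq_prod]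
  have e1 := lintegral_map (μ := gaussian ν) hφ hc
  have e2 := lintegral_withDensity_eq_lintegral_mul lebesgue hd (hφ.comp hc)
  have e3 := lintegral_map (μ := volume) (hd.mul (hφ.comp hc)) continuous_mk.measurable
  refine (e1.trans (e2.trans e3)).trans ?_
  rw [lintegral_smul_measure, hfock,
    lintegral_withDensity_eq_lintegral_mul _ hD hφ, smul_eq_mul, mul_assoc]
  have hvol2 := congrArg (fun m => ∫⁻ q, (D * φ) q ∂m) hvol
  simp only [lintegral_smul_measure, smul_eq_mul] at hvol2
  rw [← hvol2, LinearEquiv.coe_coe, lintegral_map (hD.mul hφ) hL,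
    ← lintegral_const_mul' _ _ (by norm_num)]
  refine lintegral_congr fun p => ?_
  simp only [Pi.mul_apply, Function.comp]
  rw [← mul_assoc]
  refine congrArg₂ _ ?_ rfl
  simp only [D]
  rw [← ENNReal.ofReal_mul (by positivity), norm_sq_eq_component,
    show (4 : ENNReal) = ENNReal.ofReal 4 by norm_num, ← ENNReal.ofReal_mul (by norm_num)]
  congr 1
  have e : ∀ x y : ℝ, (ν / Real.pi) ^ 2 * Real.exp (-ν * ((x + y) / 2)) =
      4 * (ν / 2 / Real.pi * Real.exp (-(ν / 2) * x) *
        (ν / 2 / Real.pi * Real.exp (-(ν / 2) * y))) := by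
    intro x y
    rw [show -ν * ((x + y) / 2) = -(ν / 2) * x + -(ν / 2) * y by ring, Real.exp_add]
    ring
  exact e _ _

/-- A function of one component is square integrable on `BC` if and only if it is so on `ℂ`. -/
theorem memLp_comp_component_iff {ν : ℝ} (hν : 0 < ν) (s : Bool) {F : ℂ → ℂ}
    (hF : Continuous F) :
    MemLp (fun Z => F (component s Z)) 2 (gaussian ν) ↔ MemLp F 2 (Bargmann.fock (ν / 2)) := by
  have hν2 : 0 < ν / 2 := by positivity
  have hfin := Bargmann.isFiniteMeasure_fock hν2
  obtain ⟨K, hK0, hK, hmap⟩ := exists_map_gaussian ν hν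
  have hc : Measurable fun Z : BC => (component true Z, component false Z) :=
    ((continuous_component true).prodMk (continuous_component false)).measurable
  set M := Bargmann.fock (ν / 2) Set.univ
  have hM0 : M ≠ 0 := fun h => by
    have := Bargmann.volume_absolutelyContinuous_fock hν2 h
    simp at this
  have hM : M ≠ ⊤ := measure_ne_top _ _
  have h1 : (gaussian ν).map (component s) = (K * M) • Bargmann.fock (ν / 2) := by
    cases s
    · have : (component false : BC → ℂ) =
        Prod.snd ∘ fun Z : BC => (component true Z, component false Z) := rfl
      rw [this, ← Measure.map_map measurable_snd hc, hmap, Measure.map_smul,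
        Measure.map_snd_prod, smul_smul]
    · have : (component true : BC → ℂ) =
        Prod.fst ∘ fun Z : BC => (component true Z, component false Z) := rfl
      rw [this, ← Measure.map_map measurable_fst hc, hmap, Measure.map_smul,
        Measure.map_fst_prod, smul_smul]
  have h2 := memLp_map_measure_iff (p := 2) (μ := gaussian ν) (g := F) (f := component s)
    hF.aestronglyMeasurable (continuous_component s).measurable.aemeasurable
  rw [h1] at h2
  refine h2.symm.trans ⟨fun h => ?_, fun h => h.smul_measure (ENNReal.mul_ne_top hK hM)⟩
  have h3 := h.smul_measure (c := (K * M)⁻¹) (ENNReal.inv_ne_top.2 (mul_ne_zero hK0 hM0))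
  rwa [smul_smul, ENNReal.inv_mul_cancel (mul_ne_zero hK0 hM0) (ENNReal.mul_ne_top hK hM),
    one_smul] at h3

/-- Holomorphy separates the components, and each marginal of the Gaussian measure is a finite
nonzero multiple of the planar one. The bicomplex space is therefore two independent copies of the
classical one. -/
theorem mem_bargmannSpace_iff {ν : ℝ} (hν : 0 < ν) {f : BC → BC} :
    f ∈ bargmannSpace ν ↔ ∃ F : Bool → ℂ → ℂ, ∀ s, Differentiable ℂ (F s) ∧
      MemLp (F s) 2 (Bargmann.fock (ν / 2)) ∧ ∀ Z, component s (f Z) = F s (component s Z) := by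
  constructor
  · rintro ⟨hol, hL⟩
    choose F hF hfF using hol.exists_entire
    refine ⟨F, fun s => ⟨hF s, ?_, hfF s⟩⟩
    rw [← memLp_comp_component_iff hν s (hF s).continuous]
    simpa only [hfF] using memLp_iff_component.1 hL s
  · rintro ⟨F, hF⟩
    refine ⟨holomorphic_of_entire (fun s => (hF s).1) fun s => (hF s).2.2,
      memLp_iff_component.2 fun s => ?_⟩
    simp only [(hF s).2.2]
    exact (memLp_comp_component_iff hν s (hF s).1.continuous).2 (hF s).2.1

/-! ### The bicomplex Segal-Bargmann transform by components -/

open Bargmann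

/-- `Ring.inverse` is `0` off the units, so both `1 - θ²` and its square root must avoid the null
cone. -/
theorem component_frftKernel (σ : ℝ) {θ : BC} (hθ : 1 - θ ^ 2 ∉ nullCone) (s : Bool) (x y : ℝ) :
    component s (frftKernel σ θ x y) = fracKernel σ (component s θ) x y := by
  have hsq : sqrt (1 - θ ^ 2) ∉ nullCone := by
    rw [notMem_nullCone_iff] at hθ ⊢
    intro r
    rw [component_sqrt, Complex.cpow_ne_zero_iff_of_exponent_ne_zero (by norm_num)]
    exact hθ r
  simp only [frftKernel, fracKernel, map_mul, map_neg, map_sub, map_pow, component_exp,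
    component_ofReal, component_inverse hsq, component_inverse hθ, component_sqrt, map_one]

theorem component_bargmannIntegrand (σ ν : ℝ) (φ : ℝ → BC) (Z : BC) (s : Bool) (x : ℝ) :
    component s (bargmannIntegrand σ ν φ Z x) =
      Complex.exp (-(σ * (x - √(ν / (4 * σ)) * component s Z) ^ 2)) * component s (φ x) := by
  simp only [bargmannIntegrand, map_mul, map_neg, map_sub, map_pow, component_exp,
    component_ofReal]

theorem memLp_component {σ : ℝ} (ψ : L2 σ) (s : Bool) :
    MemLp (fun x => component s (ψ x)) 2 (realGaussian σ) :=
  memLp_iff_component.1 (Lp.memLp ψ) s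

theorem L2_ext_component {σ : ℝ} {ψ φ : L2 σ}
    (h : ∀ s, (fun x => component s (ψ x)) =ᵐ[realGaussian σ] fun x => component s (φ x)) :
    ψ = φ := by
  refine Lp.ext ?_
  filter_upwards [h true, h false] with x h1 h2
  exact ext_component fun s => by cases s <;> assumption

theorem integrable_bargmannIntegrand {σ : ℝ} (hσ : 0 < σ) (ν : ℝ) (ψ : L2 σ) (Z : BC) :
    Integrable (bargmannIntegrand σ ν ψ Z) := by
  refine integrable_iff_component.2 fun s => ?_
  simp only [component_bargmannIntegrand]
  exact integrable_gaussian_shift_mul hσ _ (memLp_component ψ s) _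

theorem component_bargmann {σ : ℝ} (hσ : 0 < σ) (ν : ℝ) (ψ : L2 σ) (Z : BC) (s : Bool) :
    component s (bargmann σ ν ψ Z) =
      segal σ √(ν / (4 * σ)) (fun x => component s (ψ x)) (component s Z) := by
  rw [bargmann, map_mul, component_ofReal,
    component_integral (integrable_bargmannIntegrand hσ ν ψ Z), segal]
  simp only [component_bargmannIntegrand]

/-- The scaling `a = √(ν/(4σ))` is the one for which the natural parameter `2σa²` of the
one-variable transform is the `ν / 2` of the components. -/
theorem two_mul_sq_sqrt {σ ν : ℝ} (hσ : 0 < σ) (hν : 0 < ν) :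
    2 * σ * √(ν / (4 * σ)) ^ 2 = ν / 2 := by
  rw [Real.sq_sqrt (by positivity)]
  field_simp
  norm_num

theorem bargmann_mem_bargmannSpace {σ ν : ℝ} (hσ : 0 < σ) (hν : 0 < ν) (ψ : L2 σ) :
    bargmann σ ν ψ ∈ bargmannSpace ν := by
  rw [mem_bargmannSpace_iff hν]
  refine ⟨fun s => segal σ √(ν / (4 * σ)) fun x => component s (ψ x), fun s =>
    ⟨differentiable_segal hσ _ (memLp_component ψ s), ?_, fun Z => component_bargmann hσ ν ψ Z s⟩⟩
  rw [← two_mul_sq_sqrt hσ hν]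
  exact memLp_segal hσ (Real.sqrt_pos.2 (by positivity)) (memLp_component ψ s)

theorem injective_bargmann {σ ν : ℝ} (hσ : 0 < σ) (hν : 0 < ν) :
    Function.Injective (bargmann σ ν) := by
  intro ψ φ h
  have ha : 0 < √(ν / (4 * σ)) := Real.sqrt_pos.2 (by positivity)
  refine L2_ext_component fun s => ?_
  have hψ := memLp_component ψ s
  have hφ := memLp_component φ s
  have h0 : segal σ √(ν / (4 * σ)) ((fun x => component s (ψ x)) - fun x => component s (φ x)) =
      0 := by
    funext z
    have := congrArg (component s) (congrFun h (algebraMap ℂ BC z))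
    rw [component_bargmann hσ, component_bargmann hσ, component_algebraMap] at this
    rw [segal_sub hσ _ hψ hφ, this, sub_self, Pi.zero_apply]
  have h1 := eLpNorm_segal hσ ha (hψ.sub hφ)
  rw [h0, eLpNorm_zero, eq_comm, eLpNorm_eq_zero_iff (hψ.sub hφ).1 (by norm_num)] at h1
  exact sub_ae_eq_zero _ _ |>.1 h1

theorem surjOn_bargmann {σ ν : ℝ} (hσ : 0 < σ) (hν : 0 < ν) :
    Set.SurjOn (bargmann σ ν) Set.univ (bargmannSpace ν) := by
  intro f hf
  obtain ⟨F, hF⟩ := (mem_bargmannSpace_iff hν).1 hf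
  have ha : 0 < √(ν / (4 * σ)) := Real.sqrt_pos.2 (by positivity)
  have hex : ∀ s, ∃ ψ : ℝ → ℂ, MemLp ψ 2 (realGaussian σ) ∧ segal σ √(ν / (4 * σ)) ψ = F s :=
    fun s => exists_segal_eq hσ ha (hF s).1 (by rw [two_mul_sq_sqrt hσ hν]; exact (hF s).2.1)
  choose ψ hψ hψF using hex
  have hΨ : MemLp (fun x => ofComponents fun s => ψ s x) 2 (realGaussian σ) :=
    memLp_iff_component.2 fun s => by simpa only [component_ofComponents] using hψ s
  refine ⟨hΨ.toLp _, trivial, ?_⟩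
  funext Z
  refine ext_component fun s => ?_
  have hae : (fun x => component s (hΨ.toLp _ x)) =ᵐ[realGaussian σ] ψ s := by
    filter_upwards [hΨ.coeFn_toLp] with x hx
    rw [hx, component_ofComponents _ fun s => ψ s x]
  rw [component_bargmann hσ, segal_congr hσ hae, hψF, (hF s).2.2]

theorem mapsTo_dilation {ν : ℝ} (hν : 0 < ν) {θ : BC} (hθ : ∀ s, ‖component s θ‖ = 1) :
    Set.MapsTo (dilation θ) (bargmannSpace ν) (bargmannSpace ν) := by
  intro f hf
  obtain ⟨F, hF⟩ := (mem_bargmannSpace_iff hν).1 hf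
  refine (mem_bargmannSpace_iff hν).2 ⟨fun s z => F s (component s θ * z), fun s => ⟨?_, ?_, ?_⟩⟩
  · exact (hF s).1.comp (by fun_prop)
  · exact (hF s).2.1.comp_measurePreserving (measurePreserving_mul_fock _ (hθ s))
  · intro Z
    rw [dilation, (hF s).2.2, map_mul]

/-! ### The bicomplex fractional Fourier transform -/

theorem integrableOn_mul_frftKernel {σ : ℝ} (hσ : 0 < σ) {θ : BC} (hθ : 1 - θ ^ 2 ∉ nullCone)
    (ψ : L2 σ) (R y : ℝ) :
    IntegrableOn (fun x => ψ x * frftKernel σ θ x y) (Set.Icc (-R) R) := by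
  refine integrable_iff_component.2 fun s => ?_
  simp only [map_mul, component_frftKernel σ hθ]
  exact integrableOn_mul_fracKernel hσ _ (memLp_component ψ s) R y

theorem indicator_mul_frftKernel (σ : ℝ) (θ : BC) (ψ : ℝ → BC) (R y : ℝ) :
    (fun x => (Set.Icc (-R) R).indicator ψ x * frftKernel σ θ x y) =
      (Set.Icc (-R) R).indicator fun x => ψ x * frftKernel σ θ x y := by
  funext x
  by_cases hx : x ∈ Set.Icc (-R) R <;> simp [hx]

theorem component_frftIntegral_indicator {σ : ℝ} (hσ : 0 < σ) {θ : BC}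
    (hθ : 1 - θ ^ 2 ∉ nullCone) (ψ : L2 σ) (R : ℝ) (s : Bool) :
    (fun y => component s (frftIntegral σ θ ((Set.Icc (-R) R).indicator ψ) y)) =
      fracIntegral σ (component s θ) ((Set.Icc (-R) R).indicator fun x => component s (ψ x)) := by
  funext y
  have hi : Integrable fun x => (Set.Icc (-R) R).indicator ψ x * frftKernel σ θ x y := by
    rw [indicator_mul_frftKernel, integrable_indicator_iff measurableSet_Icc]
    exact integrableOn_mul_frftKernel hσ hθ ψ R y
  rw [frftIntegral, component_integral hi, fracIntegral]
  refine integral_congr_ae (Eventually.of_forall fun x => ?_)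
  simp only
  rw [map_mul, component_frftKernel σ hθ]
  congr 1
  by_cases hx : x ∈ Set.Icc (-R) R <;> simp [hx]

theorem component_one_sub_sq_ne_zero {θ : BC} (hθ : 1 - θ ^ 2 ∉ nullCone) (s : Bool) :
    1 - component s θ ^ 2 ≠ 0 := by
  simpa using (notMem_nullCone_iff _).1 hθ s

theorem memLp_frftIntegral_indicator {σ : ℝ} (hσ : 0 < σ) {θ : BC}
    (hn : ∀ s, ‖component s θ‖ = 1) (hθ : 1 - θ ^ 2 ∉ nullCone) (ψ : L2 σ) (R : ℝ) :
    MemLp (frftIntegral σ θ ((Set.Icc (-R) R).indicator ψ)) 2 (realGaussian σ) := by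
  refine memLp_iff_component.2 fun s => ?_
  rw [component_frftIntegral_indicator hσ hθ]
  exact (exists_tendsto_fracIntegral hσ (hn s) (component_one_sub_sq_ne_zero hθ s)
    (memLp_component ψ s)).1 R

theorem isFrFT_iff_component {σ : ℝ} (hσ : 0 < σ) {θ : BC} (hn : ∀ s, ‖component s θ‖ = 1)
    (hθ : 1 - θ ^ 2 ∉ nullCone) (ψ g : L2 σ) :
    IsFrFT σ θ ψ g ↔ ∀ s, Tendsto (fun R : ℝ => eLpNorm (fracIntegral σ (component s θ)
      ((Set.Icc (-R) R).indicator fun x => component s (ψ x)) - fun x => component s (g x)) 2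
        (realGaussian σ)) atTop (𝓝 0) := by
  have hm := memLp_frftIntegral_indicator hσ hn hθ ψ
  have h := tendsto_eLpNorm_iff_component (l := atTop) (fun R => (hm R).1) (Lp.memLp g).1
  simp only [component_frftIntegral_indicator hσ hθ] at h
  rw [← h]
  exact ⟨fun h => h.2.2, fun h => ⟨integrableOn_mul_frftKernel hσ hθ ψ, hm, h⟩⟩

theorem exists_isFrFT {σ : ℝ} (hσ : 0 < σ) {θ : BC} (hn : ∀ s, ‖component s θ‖ = 1)
    (hθ : 1 - θ ^ 2 ∉ nullCone) (ψ : L2 σ) : ∃ g : L2 σ, IsFrFT σ θ ψ g := by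
  have hex := fun s => (exists_tendsto_fracIntegral hσ (hn s) (component_one_sub_sq_ne_zero hθ s)
    (memLp_component ψ s)).2
  choose g hg hlim using hex
  have hG : MemLp (fun x => ofComponents fun s => g s x) 2 (realGaussian σ) :=
    memLp_iff_component.2 fun s => by simpa only [component_ofComponents] using hg s
  refine ⟨hG.toLp _, (isFrFT_iff_component hσ hn hθ _ _).2 fun s => ?_⟩
  refine (hlim s).congr fun R => eLpNorm_congr_ae ?_
  filter_upwards [hG.coeFn_toLp] with x hx
  rw [Pi.sub_apply, Pi.sub_apply, hx, component_ofComponents _ fun s => g s x]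

/-- The Segal-Bargmann transform intertwines the fractional Fourier transform and the dilation. -/
theorem IsFrFT.bargmann_eq {σ : ℝ} (hσ : 0 < σ) (ν : ℝ) {θ : BC}
    (hn : ∀ s, ‖component s θ‖ = 1) (hθ : 1 - θ ^ 2 ∉ nullCone) {ψ g : L2 σ}
    (h : IsFrFT σ θ ψ g) : bargmann σ ν g = dilation θ (bargmann σ ν ψ) := by
  funext Z
  refine ext_component fun s => ?_
  rw [dilation, component_bargmann hσ, component_bargmann hσ, map_mul]
  exact segal_eq_of_tendsto_fracIntegral hσ _ (hn s) (component_one_sub_sq_ne_zero hθ s)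
    (memLp_component ψ s) (memLp_component g s) ((isFrFT_iff_component hσ hn hθ ψ g).1 h s) _

theorem isFrFT_frft {σ : ℝ} {θ : BC} {ψ : L2 σ} (h : ∃ g, IsFrFT σ θ ψ g) :
    IsFrFT σ θ ψ (frft σ θ ψ) := by
  rw [frft, dif_pos h]
  exact h.choose_spec

/-- Where the integral converges absolutely it is the fractional Fourier transform. -/
theorem IsFrFT.ae_eq_frftIntegral {σ : ℝ} (hσ : 0 < σ) {θ : BC} {ψ g : L2 σ}
    (h : IsFrFT σ θ ψ g) (hi : ∀ y : ℝ, Integrable fun x => ψ x * frftKernel σ θ x y) :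
    g =ᵐ[volume] frftIntegral σ θ ψ := by
  refine (volume_absolutelyContinuous_realGaussian hσ).ae_eq ?_
  obtain ⟨-, hm, hlim⟩ := h
  -- Convergence in mean implies convergence in measure, hence almost everywhere along a subsequence
  -- of integer radii; absolute convergence identifies the pointwise limit with the full integral.
  have hseq := hlim.comp (tendsto_natCast_atTop_atTop (R := ℝ))
  have hmeas := tendstoInMeasure_of_tendsto_eLpNorm two_ne_zero (fun n : ℕ => (hm n).1)
    (Lp.memLp g).1 hseq
  obtain ⟨ns, hns, hae⟩ := hmeas.exists_seq_tendsto_ae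
  filter_upwards [hae] with y hy
  refine tendsto_nhds_unique hy ?_
  have hcover : AECover (volume : Measure ℝ) atTop fun R : ℝ => Set.Icc (-R) R :=
    aecover_Icc tendsto_neg_atTop_atBot tendsto_id
  have h1 := hcover.integral_tendsto_of_countably_generated (hi y)
  have h2 : Tendsto (fun R : ℝ => frftIntegral σ θ ((Set.Icc (-R) R).indicator ψ) y) atTop
      (𝓝 (frftIntegral σ θ ψ y)) := by
    refine h1.congr fun R => ?_
    rw [frftIntegral, indicator_mul_frftKernel, integral_indicator measurableSet_Icc]
  exact h2.comp (tendsto_natCast_atTop_atTop.comp hns.tendsto_atTop)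

end BC

end

theorem mainTheorem5 (σ ν : ℝ) (hσ : 0 < σ) (hν : 0 < ν) (θ : BC)
    (hplus : ‖θ.plus‖ = 1) (hminus : ‖θ.minus‖ = 1) (hθ : 1 - θ ^ 2 ∉ BC.nullCone) :
    -- `F_θ` is well defined on `L²`, and given by the integral wherever that converges absolutely
    (∀ ψ : BC.L2 σ, ∃! g : BC.L2 σ, BC.IsFrFT σ θ ψ g) ∧
    (∀ ψ : BC.L2 σ, (∀ y : ℝ, Integrable fun x => ψ x * BC.frftKernel σ θ x y) →
      BC.frft σ θ ψ =ᵐ[volume] BC.frftIntegral σ θ ψ) ∧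
    -- the Segal-Bargmann transform is a well-defined bijection onto the Bargmann space,
    -- which the dilation preserves
    (∀ (ψ : BC.L2 σ) (Z : BC), Integrable (BC.bargmannIntegrand σ ν ψ Z)) ∧
    Set.BijOn (BC.bargmann σ ν) Set.univ (BC.bargmannSpace ν) ∧
    Set.MapsTo (BC.dilation θ) (BC.bargmannSpace ν) (BC.bargmannSpace ν) ∧
    -- `F_θ = B⁻¹ Γ_θ B`
    (∀ ψ : BC.L2 σ,
      BC.frft σ θ ψ = BC.bargmannInv σ ν (BC.dilation θ (BC.bargmann σ ν ψ))) := by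
  have hn : ∀ s, ‖BC.component s θ‖ = 1 := fun s => by cases s <;> assumption
  have hinj := BC.injective_bargmann hσ hν
  have hex := BC.exists_isFrFT hσ hn hθ
  have hspec := fun ψ => BC.isFrFT_frft (hex ψ)
  refine ⟨fun ψ => ⟨_, hspec ψ, fun g hg => hinj ?_⟩,
    fun ψ hi => (hspec ψ).ae_eq_frftIntegral hσ hi,
    BC.integrable_bargmannIntegrand hσ ν,
    ⟨fun ψ _ => BC.bargmann_mem_bargmannSpace hσ hν ψ, hinj.injOn, BC.surjOn_bargmann hσ hν⟩,
    BC.mapsTo_dilation hν hn, fun ψ => ?_⟩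
  -- Any two limits in mean have the same Segal-Bargmann transform, so injectivity gives uniqueness.
  · rw [hg.bargmann_eq hσ ν hn hθ, (hspec ψ).bargmann_eq hσ ν hn hθ]
  · rw [← (hspec ψ).bargmann_eq hσ ν hn hθ, BC.bargmannInv,
      Function.leftInverse_invFun hinj]
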